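/- Let $p$ be an odd prime, let $q$ be a power of $p$, let $m=2\ell>3$ be an even integer and $e$ a positive integer such that $m/\gcd(m,e)$ is even. Put $\epsilon=0$ if $\ell/\gcd(m,e)$ is odd and $\epsilon=\gcd(m,e)$ if $\ell/\gcd(m,e)$ is even, and let $m_p\in\mathbb{F}_p$ be the residue of $m$ modulo $p$. If $m_p\neq 0$, assume moreover that $m>2\epsilon+2$. Let $\mathrm{Tr}$ be the trace from $\mathbb{F}_{q^m}$ to $\mathbb{F}_q$, let $$D_2=\{x\in\mathbb{F}_{q^m}^*:\ \mathrm{Tr}(x^{q^e+1})=0,\ \mathrm{Tr}(x)\neq 0\},$$ and let $\mathcal{C}_{D_2}=\{(\mathrm{Tr}(bx))_{x\in D_2}: b\in\mathbb{F}_{q^m}\}$, a linear code over $\mathbb{F}_q$ of length $|D_2|$. An $[n,k,d]$ code has length $n$, dimension $k$ and minimum Hamming distance $d$, and a code is $t$-weight if its nonzero codewords have exactly $t$ different Hamming weights. 1) If $m_p\neq0$, then $\mathcal{C}_{D_2}$ is a $[(q-1)(q^{m-2}-q^{\ell+\epsilon-1}),\,m,\,(q-1)(q^{m-2}-q^{m-3}-q^{\ell+\epsilon-1}-q^{\ell+\epsilon-2})]$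 linear code over $\mathbb{F}_q$ with the weight distribution $$\begin{array}{ll} \text{Weight} & \text{Frequency}\\ 0 & 1\\ (q-1)(q^{m-2}-q^{\ell+\epsilon-1}) & q-1\\ (q-1)(q^{m-2}-q^{m-3}) & q^{m-2\epsilon-2}-1\\ (q-1)(q^{m-2}-q^{m-3}-q^{\ell+\epsilon-2}) & (q-1)(q^{m-2\epsilon-2}-q^{\ell-\epsilon-1})\\ (q-1)(q^{m-2}-q^{m-3}-q^{\ell+\epsilon-1}) & (q-1)(q^{m-2\epsilon-2}-1)\\ (q-1)(q^{m-2}-q^{m-3}-q^{\ell+\epsilon-1}-q^{\ell+\epsilon-2}) & \frac{q-1}{2}(q^{m-2\epsilon-1}-q^{\ell-\epsilon}+2q^{\ell-\epsilon-1}-2q^{m-2\epsilon-2})\\ (q-1)^2(q^{m-3}-q^{\ell+\epsilon-2}) & q^m+\frac12(q^{\ell-\epsilon+1}-q^{m-2\epsilon}-q^{m-2\epsilon-1}-q^{\ell-\epsilon}) \end{array}$$ It is $6$-weight if $m\neq 2\epsilon+4$. If $m=2\epsilon+4$, the weights in the second and third rows of the table coincide, their frequencies have to be added, and the code is $5$-weight.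 2) If $m_p=0$, then $\mathcal{C}_{D_2}$ is a $4$-weight $[(q-1)q^{m-2},\,m,\,(q-1)(q^{m-2}-q^{m-3}-q^{\ell+\epsilon-2})]$ linear code over $\mathbb{F}_q$ with the weight distribution $$\begin{array}{ll} \text{Weight} & \text{Frequency}\\ 0 & 1\\ (q-1)q^{m-2} & q-1\\ (q-1)^2(q^{m-3}+q^{\ell+\epsilon-2}) & (q-1)q^{m-2\epsilon-2}\\ (q-1)(q^{m-2}-q^{m-3}-q^{\ell+\epsilon-2}) & (q-1)^2q^{m-2\epsilon-2}\\ (q-1)(q^{m-2}-q^{m-3}) & q^m-q^{m-2\epsilon}+q^{m-2\epsilon-1}-q \end{array}$$ -/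

import Mathlib

namespace TraceCode

/-! ### Linear codes

A linear code over `F` with coordinates indexed by the finite type `ι` is a subspace of `ι → F`. -/

section Codes

variable {F ι : Type*} [Field F] [DecidableEq F] [Fintype ι]

/-- The number `A_i` of codewords of Hamming weight `i`. -/
noncomputable def weightCount (C : Submodule F (ι → F)) (i : ℕ) : ℕ :=
  Set.ncard {c : ι → F | c ∈ C ∧ hammingNorm c = i}

/-- `d` is the minimum Hamming distance of `C`: the least distance between two distinct
codewords (in particular there are two distinct codewords). -/
def IsMinDist (C : Submodule F (ι → F)) (d : ℕ) : Prop :=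
  IsLeast {w : ℕ | ∃ x ∈ C, ∃ y ∈ C, x ≠ y ∧ hammingDist x y = w} d

/-- `C` is an `[n, k, d]` linear code. The length and the distance are allowed to be given by
integer expressions, so that no truncated subtraction occurs in them. -/
def IsCode (C : Submodule F (ι → F)) (n : ℤ) (k : ℕ) (d : ℤ) : Prop :=
  (Fintype.card ι : ℤ) = n ∧ Module.finrank F C = k ∧ ∃ δ : ℕ, (δ : ℤ) = d ∧ IsMinDist C δ

/-- `C` is a `t`-weight code: exactly `t` positive integers are weights of codewords. -/
def IsWeightCode (C : Submodule F (ι → F)) (t : ℕ) : Prop :=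
  Set.ncard {i : ℕ | 0 < i ∧ weightCount C i ≠ 0} = t

/-- `C` has the weight distribution given by a table of rows `(weight, frequency)`: for every `i`,
the number of codewords of weight `i` is the sum of the frequencies of the rows with weight `i`
(and `0` if there is no such row). -/
def HasWeightTable (C : Submodule F (ι → F)) (table : List (ℤ × ℚ)) : Prop :=
  ∀ i : ℕ, (weightCount C i : ℚ) =
    (table.map fun r => if r.1 = (i : ℤ) then r.2 else 0).sum

end Codes

/-! ### The codes `C_D` and the defining sets

Here `F` is the field with `q` elements and `K` its extension of degree `m`. The coordinates of
`C_D` are indexed by the elements of `D` themselves. -/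

section TraceCodes

variable (F : Type*) {K : Type*} [Field F] [Field K] [Algebra F K]

/-- The linear map `b ↦ (Tr (b x))_{x ∈ D}`. -/
noncomputable def traceWord (D : Finset K) : K →ₗ[F] (D → F) :=
  LinearMap.pi fun x => Algebra.trace F K ∘ₗ LinearMap.mulRight F (x : K)

/-- The code `C_D = {(Tr (b x))_{x ∈ D} : b ∈ K}` with defining set `D`. -/
noncomputable def code (D : Finset K) : Submodule F (D → F) :=
  LinearMap.range (traceWord F D)

theorem traceWord_apply (D : Finset K) (b : K) (x : D) :
    traceWord F D b x = Algebra.trace F K (b * (x : K)) := rfl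

variable {F}
variable (K)
variable [Fintype F] [Fintype K] [DecidableEq F] [DecidableEq K]

/-- `E₁ = {x ≠ 0 : Tr (x ^ (q ^ e + 1)) = u}`, where `q = |F|`. -/
noncomputable def setE1 (e : ℕ) (u : F) : Finset K :=
  Finset.univ.filter fun x : K =>
    x ≠ 0 ∧ Algebra.trace F K (x ^ (Fintype.card F ^ e + 1)) = u

/-- `E₂ = {x ≠ 0 : Tr x = v}`. -/
noncomputable def setE2 (v : F) : Finset K :=
  Finset.univ.filter fun x : K => x ≠ 0 ∧ Algebra.trace F K x = v

/-- `D₂ = E₁ \ E₂ = {x ≠ 0 : Tr (x ^ (q ^ e + 1)) = u, Tr x ≠ v}`. -/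
noncomputable def setD2 (e : ℕ) (u v : F) : Finset K :=
  setE1 K e u \ setE2 K v

end TraceCodes

/-- For `m = 2 * ℓ`: `0` if `ℓ / gcd (m, e)` is odd, and `gcd (m, e)` if it is even. (It is used
only when `m / gcd (m, e)` is even, so that `gcd (m, e)` divides `ℓ`.) -/
def eps (m e : ℕ) : ℕ :=
  if Odd (m / 2 / Nat.gcd m e) then 0 else Nat.gcd m e

end TraceCode

/-! Let σ be the `e`-th power of the Frobenius and Q(x) = Tr(x σ(x)). The defining set consists of
the zeros of Q with nonzero trace. Q is a quadratic form with polar form Tr(L(x) y), where L = σ +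
σ⁻¹ is self-adjoint, so its radical is ker L and the annihilator of ker L is im L. By
inclusion-exclusion (`codeWeight_eq_card`) the weight of the codeword of b is N(0) − N(1) − N(b) +
N(1, b), where N counts the zeros x of Q with Tr(ax) = 0 for every listed a.

These N are character sums (`card_zeros_annihilator`). Completing the square turns each one into
Gauss sums S(z) = ∑ χ(zQ(x)), and everything rests on S(z) = −q^(ℓ+ε) for all z ≠ 0
(`sum_addChar_normForm_frobenius`). Since x ↦ x σ(x) takes every value in Fˣ, S(z) does not depend
on z; hence S² = S(1)S(−1) = |K| |ker L| = q^(2ℓ+2ε). The sign comes from a congruence: with d =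
gcd(m, e), the group of order q^d + 1 acts on the nonzero vectors and preserves Q, so S ≡ 1 modulo
q^d + 1, whereas q^(ℓ+ε) ≡ −1.

The element h = 1/2 satisfies L(h) = 1 and Q(h) = m/4, so the residue of m decides whether h is
isotropic. For b outside F, the weight depends only on whether b = L(c) for some c and, if so, on
the binary form Q(sh + tc) = s² Q(h) + st Tr(c) + t² Q(c), through its number of zeros and the
vanishing of Q(c). If Q(h) ≠ 0 the zeros are governed by the discriminant Tr(c)² − 4 Q(h) Q(c); if
Q(h) = 0 they are governed by Tr(c) and Q(c).

Frequencies are found by counting preimages c, each b in im L having |ker L| of them. The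
discriminant is handled by averaging over the translates th + c (`sum_card_sqrts_disc`): a root t of
Q(th + c) corresponds to the square root Tr(th + c) of the discriminant, which reduces these counts
to N(0) and N(1). The resulting linear equations determine all frequencies. They are positive, so
every listed weight occurs. -/

namespace TraceCode

/-! ### The quadratic form and its polar map -/

section NormForm

variable {F K : Type*} [Field F] [Field K] [Algebra F K]

/-- The quadratic form `x ↦ Tr (x σ(x))`. -/
noncomputable def normForm (σ : K ≃ₐ[F] K) (x : K) : F := Algebra.trace F K (x * σ x)

/-- The self-adjoint map `σ + σ⁻¹` representing the polar form of `normForm σ`. -/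
noncomputable def polarMap (σ : K ≃ₐ[F] K) : K →ₗ[F] K := σ.toLinearMap + σ.symm.toLinearMap

theorem polarMap_apply (σ : K ≃ₐ[F] K) (x : K) : polarMap σ x = σ x + σ.symm x := rfl

/-- The trace is invariant under σ, so σ⁻¹ is the adjoint of σ for the trace form; this makes σ +
σ⁻¹ self-adjoint. -/
theorem trace_mul_symm (σ : K ≃ₐ[F] K) (x y : K) :
    Algebra.trace F K (σ.symm x * y) = Algebra.trace F K (x * σ y) := by
  rw [← Algebra.trace_eq_of_algEquiv σ (σ.symm x * y), map_mul, AlgEquiv.apply_symm_apply]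

theorem trace_mul_polarMap (σ : K ≃ₐ[F] K) (x y : K) :
    Algebra.trace F K (x * polarMap σ y) = Algebra.trace F K (polarMap σ x * y) := by
  have h := trace_mul_symm σ y x
  rw [mul_comm, mul_comm y] at h
  simp only [polarMap_apply, mul_add, add_mul, map_add, trace_mul_symm, h]
  ring

theorem normForm_add (σ : K ≃ₐ[F] K) (x y : K) :
    normForm σ (x + y) = normForm σ x + normForm σ y + Algebra.trace F K (polarMap σ x * y) := by
  simp only [normForm, polarMap_apply, map_add, add_mul, mul_add, trace_mul_symm, mul_comm (σ x) y]
  ring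

theorem two_mul_normForm (σ : K ≃ₐ[F] K) (x : K) :
    2 * normForm σ x = Algebra.trace F K (polarMap σ x * x) := by
  simp only [normForm, polarMap_apply, map_add, add_mul, trace_mul_symm, mul_comm (σ x) x]
  ring

theorem normForm_smul (σ : K ≃ₐ[F] K) (t : F) (x : K) :
    normForm σ (t • x) = t ^ 2 * normForm σ x := by
  simp only [normForm, map_smul, smul_mul_assoc, mul_smul_comm, smul_eq_mul]
  ring

@[simp] theorem normForm_zero (σ : K ≃ₐ[F] K) : normForm σ 0 = 0 := by simp [normForm]

theorem normForm_eq_zero_of_polarMap_eq_zero (h2 : (2 : F) ≠ 0) {σ : K ≃ₐ[F] K} {x : K}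
    (hx : polarMap σ x = 0) : normForm σ x = 0 := by
  have := two_mul_normForm σ x
  rw [hx, zero_mul, map_zero] at this
  exact (mul_eq_zero.1 this).resolve_left h2

/-- `normForm σ` factors through `polarMap σ`. -/
theorem normForm_eq_of_polarMap_eq (h2 : (2 : F) ≠ 0) {σ : K ≃ₐ[F] K} {x y : K}
    (hxy : polarMap σ x = polarMap σ y) : normForm σ x = normForm σ y := by
  have h : polarMap σ (x - y) = 0 := by rw [map_sub, hxy, sub_self]
  have := normForm_add σ (x - y) y
  rwa [h, zero_mul, map_zero, normForm_eq_zero_of_polarMap_eq_zero h2 h, sub_add_cancel, zero_add,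
    add_zero] at this

/-- Multiplication by such a `u` is a similitude of factor `a`: for `a = 1` it yields symmetries of
the form, for general `a` it rescales Gauss sums. -/
theorem normForm_mul_of_mul_eq (σ : K ≃ₐ[F] K) {u : K} {a : F} (hu : u * σ u = algebraMap F K a)
    (x : K) : normForm σ (u * x) = a * normForm σ x := by
  rw [normForm, normForm, map_mul σ, show u * x * (σ u * σ x) = (u * σ u) * (x * σ x) by ring, hu,
    ← Algebra.smul_def, map_smul, smul_eq_mul]

theorem trace_mul_left_eq_zero_iff [FiniteDimensional F K] [Algebra.IsSeparable F K] (b : K) :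
    (∀ x, Algebra.trace F K (b * x) = 0) ↔ b = 0 := by
  refine ⟨fun h => (traceForm_nondegenerate F K).1 b h, ?_⟩
  rintro rfl x
  simp

/-- The range of the self-adjoint map `polarMap σ` is the annihilator of its kernel. -/
theorem exists_trace_mul_ne_zero [FiniteDimensional F K] [Algebra.IsSeparable F K]
    {σ : K ≃ₐ[F] K} {b : K} (hb : b ∉ LinearMap.range (polarMap σ)) :
    ∃ r, polarMap σ r = 0 ∧ Algebra.trace F K (b * r) ≠ 0 := by
  obtain ⟨f, hfb, hf⟩ := Submodule.exists_dual_map_eq_bot_of_notMem hb inferInstance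
  obtain ⟨r, rfl⟩ := ((Algebra.traceForm F K).toDual (traceForm_nondegenerate F K)).surjective f
  simp only [LinearMap.BilinForm.toDual_def, Algebra.traceForm_apply] at hfb
  refine ⟨r, ?_, by rwa [mul_comm]⟩
  rw [← trace_mul_left_eq_zero_iff (F := F)]
  intro x
  rw [← trace_mul_polarMap]
  have : (((Algebra.traceForm F K).toDual (traceForm_nondegenerate F K)) r) (polarMap σ x) ∈
      (LinearMap.range (polarMap σ)).map
        (((Algebra.traceForm F K).toDual (traceForm_nondegenerate F K)) r) :=
    Submodule.mem_map_of_mem ⟨x, rfl⟩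
  rw [hf, Submodule.mem_bot] at this
  simpa [LinearMap.BilinForm.toDual_def, Algebra.traceForm_apply] using this

end NormForm

/-! ### Additive character sums over F -/

section Characters

variable {F : Type*} [Field F]

theorem sum_addChar_linearMap {V : Type*} [AddCommGroup V] [Module F V] [Fintype V]
    {χ : AddChar F ℂ} (hχ : χ.IsPrimitive) (g : V →ₗ[F] F) [Decidable (∀ v, g v = 0)] :
    ∑ v, χ (g v) = if ∀ v, g v = 0 then (Fintype.card V : ℂ) else 0 := by
  split_ifs with h
  · simp [h]
  · push Not at h
    obtain ⟨v, hv⟩ := h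
    obtain ⟨t, ht⟩ := AddChar.ne_one_iff.1 (hχ hv)
    rw [AddChar.mulShift_apply] at ht
    have := AddChar.sum_eq_zero_of_ne_one (ψ := χ.compAddMonoidHom g.toAddMonoidHom)
      (AddChar.ne_one_iff.2 ⟨t • v, by simpa [mul_comm] using ht⟩)
    simpa using this

/-- The substitution z ↦ −1/z gives the usual orthogonality sum without its term at 0. It applies to
the factors χ(−Q(c)/z) left by completing the square. -/
theorem sum_units_addChar [Fintype F] [DecidableEq F] {χ : AddChar F ℂ} (hχ : χ.IsPrimitive) (a : F) :
    ∑ z : F with z ≠ 0, χ (-a / z) = (if a = 0 then (Fintype.card F : ℂ) else 0) - 1 := by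
  have h := AddChar.sum_mulShift a hχ
  rw [← Finset.add_sum_erase _ _ (Finset.mem_univ (0 : F)), zero_mul, AddChar.map_zero_eq_one] at h
  have e : ∑ z : F with z ≠ 0, χ (-a / z) = ∑ x ∈ Finset.univ.erase (0 : F), χ (x * a) := by
    refine Finset.sum_nbij' (fun z => -z⁻¹) (fun z => -z⁻¹) ?_ ?_ ?_ ?_ ?_ <;> simp
    intro z _
    rw [div_eq_mul_inv, mul_comm, mul_neg]
  rw [e, eq_sub_iff_add_eq', h]
  split_ifs <;> simp

end Characters

/-! ### Gauss sums of the form, with linear terms -/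

section Sums

variable {F K : Type*} [Field F] [Field K] [Fintype K] [Algebra F K]

theorem sum_addChar_trace [Finite F] [DecidableEq K] {χ : AddChar F ℂ} (hχ : χ.IsPrimitive) (b : K) :
    ∑ x : K, χ (Algebra.trace F K (b * x)) = if b = 0 then (Fintype.card K : ℂ) else 0 := by
  classical
  have := sum_addChar_linearMap hχ (Algebra.trace F K ∘ₗ LinearMap.mulLeft F b)
  simp only [LinearMap.comp_apply, LinearMap.mulLeft_apply, trace_mul_left_eq_zero_iff] at this
  exact this

/-- Completing the square. -/
theorem sum_addChar_normForm_add_of_mem {χ : AddChar F ℂ} (σ : K ≃ₐ[F] K) {z : F} (hz : z ≠ 0)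
    (c : K) :
    ∑ x : K, χ (z * normForm σ x + Algebra.trace F K (polarMap σ c * x)) =
      χ (-normForm σ c / z) * ∑ x : K, χ (z * normForm σ x) := by
  -- The shift by c/z works because zQ(c/z + x) = Q(c)/z + zQ(x) + Tr(L(c)x).
  rw [Finset.mul_sum, ← Equiv.sum_comp (Equiv.addLeft (z⁻¹ • c))
    (fun x => χ (-normForm σ c / z) * χ (z * normForm σ x))]
  refine Finset.sum_congr rfl fun x _ => ?_
  rw [← AddChar.map_add_eq_mul, Equiv.coe_addLeft, normForm_add, normForm_smul, map_smul,
    smul_mul_assoc, map_smul, smul_eq_mul]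
  congr 1
  field_simp
  ring

/-- Some r in the radical has Tr(br) ≠ 0. Translation by a multiple of r fixes the quadratic part
and multiplies the sum by a nontrivial character value, so the sum vanishes. -/
theorem sum_addChar_normForm_add_of_notMem [Finite F] (h2 : (2 : F) ≠ 0) {χ : AddChar F ℂ}
    (hχ : χ.IsPrimitive) {σ : K ≃ₐ[F] K} (z : F) {b : K}
    (hb : b ∉ LinearMap.range (polarMap σ)) :
    ∑ x : K, χ (z * normForm σ x + Algebra.trace F K (b * x)) = 0 := by
  obtain ⟨r, hr, hbr⟩ := exists_trace_mul_ne_zero hb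
  obtain ⟨t, ht⟩ := AddChar.ne_one_iff.1 (hχ hbr)
  rw [AddChar.mulShift_apply] at ht
  refine eq_zero_of_mul_eq_self_left ht ?_
  rw [Finset.mul_sum]
  refine Fintype.sum_equiv (Equiv.addLeft (t • r)) _ _ fun x => ?_
  rw [← AddChar.map_add_eq_mul, Equiv.coe_addLeft]
  have : normForm σ (t • r + x) = normForm σ x :=
    normForm_eq_of_polarMap_eq h2 (by simp [hr])
  rw [this, mul_add, (Algebra.trace F K).map_add, mul_smul_comm, map_smul, smul_eq_mul]
  congr 1
  ring

/-- The product of the Gauss sums of a quadratic form and of its opposite. -/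
theorem sum_addChar_normForm_mul_sum_neg [Finite F] (h2 : (2 : F) ≠ 0) {χ : AddChar F ℂ}
    (hχ : χ.IsPrimitive) (σ : K ≃ₐ[F] K) :
    (∑ x : K, χ (normForm σ x)) * ∑ x : K, χ (-normForm σ x) =
      Fintype.card K * Nat.card (LinearMap.ker (polarMap σ)) := by
  classical
  rw [mul_comm, Finset.sum_mul_sum]
  -- Substituting x = u + y cancels Q(y). The remaining sum over y is linear and survives only for u
  -- in the radical, where Q(u) = 0.
  have : ∀ y : K, ∑ x : K, χ (-normForm σ y) * χ (normForm σ x) =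
      ∑ u : K, χ (normForm σ u) * χ (Algebra.trace F K (polarMap σ u * y)) := by
    intro y
    rw [← Equiv.sum_comp (Equiv.addRight y)]
    refine Finset.sum_congr rfl fun x _ => ?_
    rw [← AddChar.map_add_eq_mul, ← AddChar.map_add_eq_mul, Equiv.coe_addRight, normForm_add]
    congr 1
    ring
  simp_rw [this]
  rw [Finset.sum_comm]
  simp_rw [← Finset.mul_sum, sum_addChar_trace hχ]
  have : ∀ u : K, (χ (normForm σ u) * if polarMap σ u = 0 then (Fintype.card K : ℂ) else 0) =
      if polarMap σ u = 0 then (Fintype.card K : ℂ) else 0 := by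
    intro u
    split_ifs with h
    · rw [normForm_eq_zero_of_polarMap_eq_zero h2 h, AddChar.map_zero_eq_one, one_mul]
    · rw [mul_zero]
  simp_rw [this]
  rw [Finset.sum_ite, Finset.sum_const_zero, add_zero, Finset.sum_const, nsmul_eq_mul, mul_comm,
    Nat.card_eq_fintype_card, Fintype.card_subtype]
  simp only [LinearMap.mem_ker]

end Sums

/-! ### Counting zeros on annihilators by characters -/

section Counting

open scoped Classical in
/-- The number of zeros of `normForm σ` in the annihilator of the image of a linear map `f`, when
the Gauss sums of all nonzero multiples of `normForm σ` are equal to `-X`. -/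
theorem card_zeros_annihilator {F K V : Type*} [Field F] [Fintype F] [Field K] [Fintype K]
    [Algebra F K] [AddCommGroup V] [Module F V] [Fintype V]
    (h2 : (2 : F) ≠ 0) {χ : AddChar F ℂ} (hχ : χ.IsPrimitive) {σ : K ≃ₐ[F] K} {X : ℤ}
    (hS : ∀ z : F, z ≠ 0 → ∑ x : K, χ (z * normForm σ x) = -(X : ℂ)) (f : V →ₗ[F] K) :
    (Fintype.card V * Fintype.card F *
      Finset.card {x : K | normForm σ x = 0 ∧ ∀ v, Algebra.trace F K (f v * x) = 0} : ℤ) =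
    Fintype.card K * Finset.card {v : V | f v = 0} -
      X * (Fintype.card F * Finset.card {v : V | ∃ c, polarMap σ c = f v ∧ normForm σ c = 0} -
        Finset.card {v : V | f v ∈ LinearMap.range (polarMap σ)}) := by
  -- The sum over `z` detects Q(x) = 0 and the sum over `v` detects the trace conditions; the same
  -- triple sum is then evaluated with `x` innermost.
  have hl : ∑ z : F, ∑ v : V, ∑ x : K, χ (z * normForm σ x + Algebra.trace F K (f v * x)) =
      Fintype.card V * Fintype.card F *
      Finset.card {x : K | normForm σ x = 0 ∧ ∀ v, Algebra.trace F K (f v * x) = 0} := by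
    have h : ∀ x : K, ∑ z : F, ∑ v : V, χ (z * normForm σ x + Algebra.trace F K (f v * x)) =
        if normForm σ x = 0 ∧ ∀ v, Algebra.trace F K (f v * x) = 0 then
          (Fintype.card V * Fintype.card F : ℂ) else 0 := by
      intro x
      have h1 := AddChar.sum_mulShift (normForm σ x) hχ
      have h3 := sum_addChar_linearMap hχ
        (Algebra.trace F K ∘ₗ LinearMap.mulRight F x ∘ₗ f)
      simp only [LinearMap.comp_apply, LinearMap.mulRight_apply] at h3
      simp_rw [AddChar.map_add_eq_mul, ← Finset.mul_sum, ← Finset.sum_mul, h1, h3]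
      by_cases hx : normForm σ x = 0 <;>
        by_cases hv : ∀ v, Algebra.trace F K (f v * x) = 0 <;> simp [hx, mul_comm]
    have : ∀ z : F, ∑ v : V, ∑ x : K, χ (z * normForm σ x + Algebra.trace F K (f v * x)) =
        ∑ x : K, ∑ v : V, χ (z * normForm σ x + Algebra.trace F K (f v * x)) :=
      fun z => Finset.sum_comm
    simp_rw [this]
    rw [Finset.sum_comm]
    simp_rw [h]
    rw [Finset.sum_ite, Finset.sum_const_zero, add_zero, Finset.sum_const, nsmul_eq_mul, mul_comm]
  have hr : ∀ v : V, ∑ z : F with z ≠ 0,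
      ∑ x : K, χ (z * normForm σ x + Algebra.trace F K (f v * x)) =
      -X * (Fintype.card F * (if ∃ c, polarMap σ c = f v ∧ normForm σ c = 0 then 1 else 0) -
        (if f v ∈ LinearMap.range (polarMap σ) then 1 else 0)) := by
    intro v
    by_cases hv : f v ∈ LinearMap.range (polarMap σ)
    · obtain ⟨c, hc⟩ := hv
      have h1 : (∃ c, polarMap σ c = f v ∧ normForm σ c = 0) ↔ normForm σ c = 0 := by
        refine ⟨?_, fun h => ⟨c, hc, h⟩⟩
        rintro ⟨c', hc', h0⟩
        rwa [normForm_eq_of_polarMap_eq h2 (hc.trans hc'.symm)]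
      rw [if_pos (show f v ∈ LinearMap.range (polarMap σ) from ⟨c, hc⟩), if_congr h1 rfl rfl,
        ← hc, Finset.sum_congr rfl fun z hz => by
        rw [sum_addChar_normForm_add_of_mem σ (Finset.mem_filter.1 hz).2,
          hS z (Finset.mem_filter.1 hz).2], ← Finset.sum_mul, sum_units_addChar hχ]
      split_ifs <;> ring
    · have h1 : ¬ ∃ c, polarMap σ c = f v ∧ normForm σ c = 0 :=
        fun ⟨c, hc, _⟩ => hv ⟨c, hc⟩
      rw [if_neg hv, if_neg h1]
      simp only [sum_addChar_normForm_add_of_notMem h2 hχ _ hv, Finset.sum_const_zero]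
      ring
  have h0 : ∑ v : V, ∑ x : K, χ (0 * normForm σ x + Algebra.trace F K (f v * x)) =
      Fintype.card K * Finset.card {v : V | f v = 0} := by
    simp_rw [zero_mul, zero_add, sum_addChar_trace hχ]
    rw [Finset.sum_ite, Finset.sum_const_zero, add_zero, Finset.sum_const, nsmul_eq_mul, mul_comm]
  have key : ∑ z : F, ∑ v : V, ∑ x : K, χ (z * normForm σ x + Algebra.trace F K (f v * x)) =
      Fintype.card K * Finset.card {v : V | f v = 0} + ∑ v : V,
      -(X : ℂ) * (Fintype.card F * (if ∃ c, polarMap σ c = f v ∧ normForm σ c = 0 then 1 else 0) -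
        (if f v ∈ LinearMap.range (polarMap σ) then 1 else 0)) := by
    rw [← Finset.add_sum_erase _ _ (Finset.mem_univ (0 : F)), h0, ← Finset.filter_ne',
      Finset.sum_comm]
    simp_rw [hr]
  rw [hl, ← Finset.mul_sum, Finset.sum_sub_distrib, ← Finset.mul_sum, Finset.sum_boole,
    Finset.sum_boole] at key
  have : ((Fintype.card V * Fintype.card F *
      Finset.card {x : K | normForm σ x = 0 ∧ ∀ v, Algebra.trace F K (f v * x) = 0} : ℤ) : ℂ) =
    ((Fintype.card K * Finset.card {v : V | f v = 0} -
      X * (Fintype.card F * Finset.card {v : V | ∃ c, polarMap σ c = f v ∧ normForm σ c = 0} -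
        Finset.card {v : V | f v ∈ LinearMap.range (polarMap σ)}) : ℤ) : ℂ) := by
    push_cast
    rw [key]
    ring
  exact_mod_cast this

end Counting

/-! ### The order of the radical -/

section Kernel

variable {F K : Type*} [Field F] [Field K] [Algebra F K]

theorem polarMap_eq_zero_iff (σ : K ≃ₐ[F] K) (x : K) : polarMap σ x = 0 ↔ (σ ^ 2) x = -x := by
  rw [← map_eq_zero_iff σ σ.injective, polarMap_apply, map_add, AlgEquiv.apply_symm_apply,
    ← AlgEquiv.mul_apply, ← sq, eq_neg_iff_add_eq_zero]

/-- For `2 ≠ 0`, the fixed space of `τ ^ 2` is the direct sum of the eigenspaces of `τ` for the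
eigenvalues `1` and `-1`. -/
theorem card_fixed_sq (h2 : (2 : K) ≠ 0) (τ : K ≃ₐ[F] K) :
    Nat.card {x // (τ ^ 2) x = x} = Nat.card {x // τ x = x} * Nat.card {x // τ x = -x} := by
  have hi : ∀ x : K, τ (x / 2) = τ x / 2 := fun x => by rw [map_div₀, map_ofNat]
  have hs : ∀ x : K, (τ ^ 2) x = τ (τ x) := fun x => by rw [sq, AlgEquiv.mul_apply]
  rw [← Nat.card_prod]
  refine Nat.card_congr
    { toFun := fun z => (⟨(z.1 + τ z.1) / 2, ?_⟩, ⟨(z.1 - τ z.1) / 2, ?_⟩)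
      invFun := fun y => ⟨y.1.1 + y.2.1, ?_⟩
      left_inv := fun z => ?_
      right_inv := fun y => ?_ }
  · have := (hs _).symm.trans z.2
    rw [hi, map_add, this, add_comm]
  · have := (hs _).symm.trans z.2
    rw [hi, map_sub, this]
    ring
  · rw [sq, AlgEquiv.mul_apply, map_add, map_add, y.1.2, y.2.2, map_neg, y.1.2, y.2.2, neg_neg]
  · ext
    simp only
    field_simp
    ring
  · obtain ⟨⟨y, hy⟩, ⟨y', hy'⟩⟩ := y
    ext
    · simp only [map_add, hy, hy']
      field_simp
      ring
    · simp only [map_add, hy, hy']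
      field_simp
      ring

/-- By Galois theory the degree of K over the fixed field is the order m / gcd(m, j) of the j-th
power of the Frobenius, which leaves degree gcd(m, j) over F. -/
theorem card_fixed_frobenius_pow [Fintype F] [Finite K] (j : ℕ) :
    Nat.card {x : K // (FiniteField.frobeniusAlgEquivOfAlgebraic F K ^ j) x = x} =
      Fintype.card F ^ (Module.finrank F K).gcd j := by
  classical
  set φ := FiniteField.frobeniusAlgEquivOfAlgebraic F K
  set E := IntermediateField.fixedField (Subgroup.zpowers (φ ^ j)) with hE
  have h1 : Module.finrank E K = Module.finrank F K / (Module.finrank F K).gcd j := by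
    rw [IntermediateField.finrank_fixedField_eq_card, Nat.card_zpowers, orderOf_pow,
      FiniteField.orderOf_frobeniusAlgEquivOfAlgebraic]
  have hpos : 0 < Module.finrank F K := Module.finrank_pos
  have hg := Nat.gcd_dvd_left (Module.finrank F K) j
  have h2 : Module.finrank F E = (Module.finrank F K).gcd j := by
    have h := Module.finrank_mul_finrank F E K
    rw [h1] at h
    refine Nat.eq_of_mul_eq_mul_right (Nat.div_pos (Nat.le_of_dvd hpos hg)
      (Nat.gcd_pos_of_pos_left _ hpos)) ?_
    rw [h, Nat.mul_div_cancel' hg]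
  have := Fintype.ofFinite E
  rw [← h2, ← Module.card_eq_pow_finrank (V := E), ← Nat.card_eq_fintype_card]
  refine Nat.card_congr (Equiv.subtypeEquivRight fun x => ?_)
  rw [hE, IntermediateField.mem_fixedField_iff]
  constructor
  · intro h f hf
    have : φ ^ j ∈ MulAction.stabilizer (K ≃ₐ[F] K) x := h
    exact (Subgroup.zpowers_le.2 this) hf
  · exact fun h => h _ (Subgroup.mem_zpowers _)

/-- The kernel is the (−1)-eigenspace of τ = σ². For odd `k`, τ^k = 1 while τ^k acts on it as −1, so
it is zero. For even `k` its order is the quotient of the orders q^(4d) and q^(2d) of the fixed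
fields of τ² and τ. -/
theorem card_ker_polarMap_frobenius [Fintype F] [Finite K] (h2 : (2 : F) ≠ 0) {d k e' : ℕ}
    (hm : Module.finrank F K = 2 * (d * k)) (hk : Nat.Coprime e' k) :
    Nat.card (LinearMap.ker
      (polarMap (FiniteField.frobeniusAlgEquivOfAlgebraic F K ^ (d * e')))) =
      Fintype.card F ^ (2 * if Odd k then 0 else d) := by
  set φ := FiniteField.frobeniusAlgEquivOfAlgebraic F K with hφ
  have h2' : (2 : K) ≠ 0 := by
    have := (map_ne_zero (algebraMap F K)).2 h2
    rwa [map_ofNat] at this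
  have h : Nat.card (LinearMap.ker (polarMap (φ ^ (d * e')))) =
      Nat.card {x : K // (φ ^ (d * e' * 2)) x = -x} :=
    Nat.card_congr (Equiv.subtypeEquivRight fun x => by
      rw [LinearMap.mem_ker, polarMap_eq_zero_iff, ← pow_mul])
  rw [h]
  split_ifs with hodd
  · rw [mul_zero, pow_zero, Nat.card_eq_one_iff_unique]
    have h0 : ∀ x : K, (φ ^ (d * e' * 2)) x = -x → x = 0 := by
      intro x hx
      have hn : ∀ n : ℕ, ((φ ^ (d * e' * 2)) ^ n) x = (-1) ^ n * x := by
        intro n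
        induction n with
        | zero => simp
        | succ n ih =>
          rw [pow_succ, AlgEquiv.mul_apply, hx, map_neg, ih]
          ring
      -- The exponent 2de'k is a multiple of the degree 2dk, which is the order of φ.
      have hone : (φ ^ (d * e' * 2)) ^ k = 1 := by
        rw [← pow_mul, show d * e' * 2 * k = 2 * (d * k) * e' by ring, ← hm,
          ← FiniteField.orderOf_frobeniusAlgEquivOfAlgebraic F K, pow_mul, pow_orderOf_eq_one,
          one_pow]
      have := hn k
      rw [hone, hodd.neg_one_pow, AlgEquiv.one_apply] at this
      have h3 : 2 * x = 0 := by linear_combination this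
      exact (mul_eq_zero.1 h3).resolve_left h2'
    exact ⟨⟨fun x y => Subtype.ext ((h0 _ x.2).trans (h0 _ y.2).symm)⟩, ⟨⟨0, by simp⟩⟩⟩
  · have h4 := card_fixed_sq h2' (φ ^ (d * e' * 2))
    rw [← pow_mul, hφ, card_fixed_frobenius_pow, card_fixed_frobenius_pow, hm] at h4
    have g2 : (2 * (d * k)).gcd (d * e' * 2) = 2 * d := by
      rw [show 2 * (d * k) = 2 * d * k by ring, show d * e' * 2 = 2 * d * e' by ring,
        Nat.gcd_mul_left, Nat.Coprime.symm hk, mul_one]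
    have g4 : (2 * (d * k)).gcd (d * e' * 2 * 2) = 2 * d + 2 * d := by
      obtain ⟨k', rfl⟩ := Nat.not_odd_iff_even.1 hodd
      rw [← two_mul] at hk ⊢
      rw [show 2 * (d * (2 * k')) = 4 * d * k' by ring,
        show d * e' * 2 * 2 = 4 * d * e' by ring,
        Nat.gcd_mul_left, (Nat.Coprime.coprime_mul_left_right hk).symm]
      ring
    rw [g2, g4, pow_add] at h4
    exact (Nat.eq_of_mul_eq_mul_left (pow_pos Fintype.card_pos _) h4).symm

end Kernel

/-! ### The value of the Gauss sum -/

section GaussSum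

/-- In a finite cyclic group, an element killed by `N / n` is an `n`-th power, where `N = n * r` is
the order of the group. -/
theorem exists_pow_eq_of_pow_eq_one {G : Type*} [CommGroup G] [IsCyclic G] [Finite G] {n r : ℕ}
    (hN : Nat.card G = n * r) {a : G} (ha : a ^ r = 1) : ∃ b : G, b ^ n = a := by
  have hle : (powMonoidHom n : G →* G).range ≤ (powMonoidHom r : G →* G).ker := by
    rintro _ ⟨b, rfl⟩
    rw [MonoidHom.mem_ker, powMonoidHom_apply, powMonoidHom_apply, ← pow_mul, ← hN, pow_card_eq_one']
  have hn : 0 < n := Nat.pos_of_ne_zero (by rintro rfl; simp [Nat.card_pos.ne'] at hN)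
  have heq : (powMonoidHom n : G →* G).range = (powMonoidHom r : G →* G).ker := by
    refine Subgroup.eq_of_le_of_card_ge hle ?_
    rw [IsCyclic.card_powMonoidHom_ker, IsCyclic.card_powMonoidHom_range, hN,
      Nat.gcd_mul_right_left, Nat.gcd_mul_left_left, Nat.mul_div_cancel_left _ hn]
  have : a ∈ (powMonoidHom n : G →* G).range := heq ▸ ha
  exact this

/-- A set stable under right multiplication by `H` is a union of left cosets of `H`. -/
theorem card_subgroup_dvd_card_of_mul_mem {G : Type*} [Group G] (H : Subgroup G) (A : Set G)
    (hA : ∀ u ∈ A, ∀ h ∈ H, u * h ∈ A) : Nat.card H ∣ Nat.card A := by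
  have : A = QuotientGroup.mk ⁻¹' ((QuotientGroup.mk : G → G ⧸ H) '' A) := by
    refine Set.Subset.antisymm (Set.subset_preimage_image _ _) ?_
    rintro u ⟨v, hv, huv⟩
    have := hA v hv _ (QuotientGroup.eq.1 huv)
    rwa [mul_inv_cancel_left] at this
  rw [this, QuotientGroup.card_preimage_mk]
  exact Dvd.intro _ rfl

variable {F K : Type*} [Field F] [Fintype F] [Field K] [Fintype K] [Algebra F K]

theorem frobenius_pow_apply (e : ℕ) (x : K) :
    (FiniteField.frobeniusAlgEquivOfAlgebraic F K ^ e) x = x ^ Fintype.card F ^ e := by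
  rw [AlgEquiv.coe_pow, FiniteField.coe_frobeniusAlgEquivOfAlgebraic_iterate]

/-- Every element of `Fˣ` is a value of `x ↦ x σ(x)`. -/
theorem exists_mul_frobenius_eq {d k e' : ℕ} (hd : 0 < d)
    (hm : Module.finrank F K = 2 * (d * k)) (he' : Odd e') {a : F} (ha : a ≠ 0) :
    ∃ u : K, u * (FiniteField.frobeniusAlgEquivOfAlgebraic F K ^ (d * e')) u = algebraMap F K a := by
  set q := Fintype.card F with hq
  have hq1 : 1 < q := Fintype.one_lt_card
  have hqd : 1 < q ^ d := Nat.one_lt_pow hd.ne' hq1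
  have hN : Nat.card Kˣ = q ^ (2 * (d * k)) - 1 := by
    rw [Nat.card_units, Nat.card_eq_fintype_card, Module.card_eq_pow_finrank (K := F), hm]
  have hdvd : q ^ (2 * d) - 1 ∣ Nat.card Kˣ := by
    rw [hN, show 2 * (d * k) = 2 * d * k by ring, pow_mul q (2 * d)]
    simpa using Nat.sub_dvd_pow_sub_pow (q ^ (2 * d)) 1 k
  have hfac : q ^ (2 * d) - 1 = (q ^ d + 1) * (q ^ d - 1) := by
    rw [mul_comm 2 d, pow_mul, ← Nat.sq_sub_sq, one_pow]
  set H := (powMonoidHom (q ^ (2 * d) - 1) : Kˣ →* Kˣ).ker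
  have hH : Nat.card H = (q ^ d + 1) * (q ^ d - 1) := by
    rw [IsCyclic.card_powMonoidHom_ker, Nat.gcd_eq_right hdvd, hfac]
  set a' : Kˣ := Units.map (algebraMap F K).toMonoidHom (Units.mk0 a ha) with ha'
  have hap : a' ^ (q ^ d - 1) = 1 := by
    obtain ⟨r, hr⟩ : q - 1 ∣ q ^ d - 1 := by simpa using Nat.sub_dvd_pow_sub_pow q 1 d
    rw [ha', ← map_pow, hr, pow_mul]
    have : (Units.mk0 a ha) ^ (q - 1) = 1 := by
      ext
      simpa using FiniteField.pow_card_sub_one_eq_one a ha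
    rw [this, one_pow, map_one]
  have haH : a' ∈ H := by
    rw [MonoidHom.mem_ker, powMonoidHom_apply, hfac, mul_comm, pow_mul, hap, one_pow]
  -- `H` is cyclic of order (q^d + 1)(q^d − 1), so elements killed by q^d − 1 are (q^d + 1)-th
  -- powers in `H`. Taking `u` in `H`, rather than just in Kˣ, is what allows reduction of the
  -- exponent of σ.
  obtain ⟨⟨u, hu⟩, huv⟩ := exists_pow_eq_of_pow_eq_one (G := H) hH
    (a := ⟨a', haH⟩) (Subtype.ext hap)
  have huv : u ^ (q ^ d + 1) = a' := congrArg Subtype.val huv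
  rw [MonoidHom.mem_ker, powMonoidHom_apply] at hu
  refine ⟨u, ?_⟩
  rw [frobenius_pow_apply, ← hq]
  -- The order of `u` divides q^(2d) − 1, so an odd multiple of d in the exponent may be replaced by
  -- d.
  have hpow : u ^ q ^ (d * e') = u ^ q ^ d := by
    obtain ⟨j, rfl⟩ := he'
    obtain ⟨r, hr⟩ : q ^ (2 * d) - 1 ∣ q ^ (2 * d * j) - 1 := by
      simpa [pow_mul] using Nat.sub_dvd_pow_sub_pow (q ^ (2 * d)) 1 j
    have h1 : q ^ (2 * d * j) = (q ^ (2 * d) - 1) * r + 1 := by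
      rw [← hr, Nat.sub_add_cancel (Nat.one_le_pow _ _ (by omega))]
    rw [show d * (2 * j + 1) = 2 * d * j + d by ring, pow_add q, h1, pow_mul, pow_succ, pow_mul, hu,
      one_pow, one_mul]
  have : u * u ^ q ^ (d * e') = a' := by rw [hpow, ← pow_succ', huv]
  simpa [ha'] using congrArg Units.val this

open scoped Classical in
/-- If `x σ(x)` represents all elements of `Fˣ`, then the Gauss sum of `normForm σ` is an integer
congruent to `1` modulo the order of every group of solutions of `u σ(u) = 1`. -/
theorem exists_sum_addChar_normForm_eq {χ : AddChar F ℂ} (hχ : χ.IsPrimitive) {σ : K ≃ₐ[F] K}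
    (hσ : ∀ a : F, a ≠ 0 → ∃ u : K, u * σ u = algebraMap F K a) (H : Subgroup Kˣ)
    (hH : ∀ u ∈ H, (u : K) * σ u = 1) :
    ∃ T : ℤ, ∑ x : K, χ (normForm σ x) = 1 + Nat.card H * T := by
  set A : F → Set Kˣ := fun a => {u | normForm σ u = a} with hA
  have hdvd : ∀ a, Nat.card H ∣ Nat.card (A a) := by
    intro a
    refine card_subgroup_dvd_card_of_mul_mem H (A a) fun u hu h hh => ?_
    rw [hA, Set.mem_ofPred_eq] at hu ⊢
    rw [Units.val_mul, mul_comm, normForm_mul_of_mul_eq σ (a := 1) (by rw [hH h hh, map_one]), hu,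
      one_mul]
  have hcard : ∀ a, a ≠ 0 → Nat.card (A a) = Nat.card (A 1) := by
    intro a ha
    obtain ⟨u, hu⟩ := hσ a ha
    have hu0 : u ≠ 0 := by
      rintro rfl
      rw [zero_mul, eq_comm, map_eq_zero] at hu
      exact ha hu
    refine (Nat.card_congr ((Equiv.mulLeft (Units.mk0 u hu0)).subtypeEquiv fun x => ?_)).symm
    simp only [hA, Set.mem_ofPred_eq, Equiv.coe_mulLeft, Units.val_mul, Units.val_mk0,
      normForm_mul_of_mul_eq σ hu, mul_right_eq_self₀]
    simp [ha]
  obtain ⟨α, hα⟩ := hdvd 0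
  obtain ⟨β, hβ⟩ := hdvd 1
  -- All fibres over nonzero values have the same size |H|β, and the nontrivial character sums to −1
  -- over Fˣ.
  refine ⟨α - β, ?_⟩
  have h1 : ∑ x : K, χ (normForm σ x) = 1 + ∑ u : Kˣ, χ (normForm σ u) := by
    rw [← Finset.add_sum_erase _ _ (Finset.mem_univ (0 : K)), normForm_zero,
      AddChar.map_zero_eq_one]
    congr 1
    symm
    refine Finset.sum_bij (fun u _ => (u : K)) ?_ ?_ ?_ ?_
    · simp
    · exact fun u _ v _ h => Units.ext h
    · exact fun x hx => ⟨Units.mk0 x (Finset.ne_of_mem_erase hx), Finset.mem_univ _, rfl⟩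
    · simp
  have h3 : ∑ u : Kˣ, χ (normForm σ u) = ∑ a : F, Nat.card (A a) * χ a := by
    rw [← Finset.sum_fiberwise Finset.univ (fun u : Kˣ => normForm σ (u : K))]
    refine Finset.sum_congr rfl fun a _ => ?_
    rw [Finset.sum_congr rfl fun u hu => by rw [(Finset.mem_filter.1 hu).2], Finset.sum_const,
      nsmul_eq_mul, Nat.card_eq_fintype_card, Fintype.card_subtype]
    rfl
  have h4 := AddChar.sum_mulShift (1 : F) hχ
  rw [if_neg one_ne_zero, ← Finset.add_sum_erase _ _ (Finset.mem_univ (0 : F))] at h4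
  simp only [mul_one, AddChar.map_zero_eq_one, Nat.cast_zero] at h4
  rw [h1, h3, ← Finset.add_sum_erase _ _ (Finset.mem_univ (0 : F)), Finset.sum_congr rfl fun a ha =>
    by rw [hcard a (Finset.ne_of_mem_erase ha)], ← Finset.mul_sum, AddChar.map_zero_eq_one, hα, hβ]
  push_cast
  linear_combination (Nat.card H * β : ℂ) * h4

/-- Scaling by solutions of u σ(u) = z makes the sum independent of `z`, so its square is |K| times
the order of the radical. The sign follows from the congruence to 1 modulo q^d + 1. -/
theorem sum_addChar_normForm_frobenius (h2 : (2 : F) ≠ 0) {χ : AddChar F ℂ} (hχ : χ.IsPrimitive)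
    {d k e' : ℕ} (hd : 0 < d) (hm : Module.finrank F K = 2 * (d * k)) (hk : Nat.Coprime e' k)
    (he' : Odd e') {z : F} (hz : z ≠ 0) :
    ∑ x : K, χ (z * normForm (FiniteField.frobeniusAlgEquivOfAlgebraic F K ^ (d * e')) x) =
      -((Fintype.card F ^ (d * k + if Odd k then 0 else d) : ℤ) : ℂ) := by
  set σ := FiniteField.frobeniusAlgEquivOfAlgebraic F K ^ (d * e') with hσ
  set q := Fintype.card F with hq
  set ε := if Odd k then 0 else d with hε
  have hsurj : ∀ a : F, a ≠ 0 → ∃ u : K, u * σ u = algebraMap F K a :=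
    fun a ha => exists_mul_frobenius_eq hd hm he' ha
  have hscale : ∀ z : F, z ≠ 0 →
      ∑ x : K, χ (z * normForm σ x) = ∑ x : K, χ (normForm σ x) := by
    intro z hz
    obtain ⟨u, hu⟩ := hsurj z hz
    have hu0 : u ≠ 0 := by
      rintro rfl
      rw [zero_mul, eq_comm, map_eq_zero] at hu
      exact hz hu
    refine Fintype.sum_equiv (Equiv.mulLeft₀ u hu0) _ _ fun x => ?_
    rw [Equiv.mulLeft₀_apply, normForm_mul_of_mul_eq σ hu]
  rw [hscale z hz]
  have hq1 : 1 < q := Fintype.one_lt_card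
  have hq3 : 3 ≤ q := by
    by_contra hlt
    have h : Fintype.card F = 2 := by omega
    exact h2 (by simpa [h] using FiniteField.cast_card_eq_zero F)
  have hqd : 3 ≤ q ^ d := hq3.trans (Nat.le_self_pow hd.ne' q)
  set H := (powMonoidHom (q ^ d + 1) : Kˣ →* Kˣ).ker
  have hHcard : Nat.card H = q ^ d + 1 := by
    rw [IsCyclic.card_powMonoidHom_ker]
    refine Nat.gcd_eq_right (Dvd.dvd.trans (Dvd.intro (q ^ d - 1) rfl) ?_)
    rw [← Nat.sq_sub_sq, ← pow_mul, one_pow, Nat.card_units, Nat.card_eq_fintype_card,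
      Module.card_eq_pow_finrank (K := F), hm, show 2 * (d * k) = d * 2 * k by ring, ← hq,
      pow_mul q (d * 2)]
    simpa using Nat.sub_dvd_pow_sub_pow (q ^ (d * 2)) 1 k
  have hH : ∀ u ∈ H, (u : K) * σ u = 1 := by
    intro u hu
    rw [MonoidHom.mem_ker, powMonoidHom_apply] at hu
    obtain ⟨r, hr⟩ := Odd.nat_add_dvd_pow_add_pow (q ^ d) 1 he'
    -- For odd e', q^d + 1 divides q^(de') + 1, so every `u` in `H` satisfies u σ(u) = 1.
    rw [one_pow, ← pow_mul] at hr
    have : u ^ (q ^ (d * e') + 1) = 1 := by rw [hr, pow_mul, hu, one_pow]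
    rw [frobenius_pow_apply, ← hq, ← pow_succ']
    rw [← Units.val_pow_eq_pow_val, this, Units.val_one]
  obtain ⟨T, hT⟩ := exists_sum_addChar_normForm_eq hχ hsurj H hH
  rw [hHcard] at hT
  have hsq := sum_addChar_normForm_mul_sum_neg h2 hχ σ
  have hneg := hscale (-1) (neg_ne_zero.2 one_ne_zero)
  simp only [neg_one_mul] at hneg
  rw [hneg, hT, card_ker_polarMap_frobenius h2 hm hk, Module.card_eq_pow_finrank (K := F), hm,
    ← hq, ← hε] at hsq
  have hsq' : (1 + (q ^ d + 1) * T) ^ 2 = ((q : ℤ) ^ (d * k + ε)) ^ 2 := by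
    have : (((1 + (q ^ d + 1) * T) ^ 2 : ℤ) : ℂ) = ((((q : ℤ) ^ (d * k + ε)) ^ 2 : ℤ) : ℂ) := by
      push_cast at hsq ⊢
      rw [sq, hsq, ← pow_add, ← pow_mul]
      congr 1
      ring
    exact_mod_cast this
  -- The value of ε is exactly what makes dk + ε an odd multiple of d, for either parity of k.
  have hdvd : ((q : ℤ) ^ d + 1) ∣ (q : ℤ) ^ (d * k + ε) + 1 := by
    have : ∃ j, Odd j ∧ d * k + ε = d * j := by
      rw [hε]
      split_ifs with h
      · exact ⟨k, h, rfl⟩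
      · exact ⟨k + 1, (Nat.not_odd_iff_even.1 h).add_one, by ring⟩
    obtain ⟨j, hj, hj'⟩ := this
    rw [hj', pow_mul]
    simpa using Odd.add_dvd_pow_add_pow ((q : ℤ) ^ d) 1 hj
  have hval : (1 + (q ^ d + 1) * T : ℤ) = -(q : ℤ) ^ (d * k + ε) := by
    refine (sq_eq_sq_iff_eq_or_eq_neg.1 hsq').resolve_left fun h => ?_
    rw [← h] at hdvd
    -- With the plus sign, q^d + 1 would divide both S + 1 and S − 1, hence 2.
    have h3 : ((q : ℤ) ^ d + 1) ∣ 2 := by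
      have := hdvd.sub (Dvd.intro T rfl)
      ring_nf at this ⊢
      simpa using this
    have := Int.le_of_dvd (by norm_num) h3
    have : (3 : ℤ) ≤ (q : ℤ) ^ d := by exact_mod_cast hqd
    omega
  rw [hT]
  have := congrArg (Int.cast : ℤ → ℂ) hval
  push_cast at this ⊢
  exact this

end GaussSum

/-! ### Square roots and zeros of binary quadratic forms over F -/

section FiniteFieldCounts

open scoped Classical in
theorem card_filter_prod_right {α β : Type*} [Fintype α] [Fintype β] (P : α → β → Prop) :
    Finset.card {p : α × β | P p.1 p.2} = ∑ t, Finset.card {s | P s t} := by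
  simp only [Finset.card_filter, Fintype.sum_prod_type_right]

theorem card_filter_eq_sum_fibers {α β : Type*} [Fintype α] [DecidableEq β] (g : α → β)
    (J : Finset β) {P : α → Prop} [DecidablePred P] (h : ∀ a, P a ↔ g a ∈ J) :
    Finset.card {a | P a} = ∑ j ∈ J, Finset.card {a | g a = j} := by
  rw [Finset.card_eq_sum_card_fiberwise (f := g) (t := J) (fun a ha => (h a).1 (by simpa using ha))]
  refine Finset.sum_congr rfl fun j hj => congrArg Finset.card ?_
  ext a
  simp only [Finset.mem_filter, Finset.mem_univ, true_and, and_iff_right_iff_imp]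
  rintro rfl
  exact (h a).2 hj

variable {F : Type*} [Field F] [Fintype F]

open scoped Classical in
theorem card_sqrts_zero : Finset.card {u : F | u ^ 2 = 0} = 1 := by
  rw [Finset.card_eq_one]
  exact ⟨0, by ext; simp⟩

open scoped Classical in
theorem card_sqrts_of_isSquare (h2 : (2 : F) ≠ 0) {D : F} (hD : D ≠ 0) (hs : IsSquare D) :
    Finset.card {u : F | u ^ 2 = D} = 2 := by
  obtain ⟨r, rfl⟩ := hs
  have hr : r ≠ 0 := by rintro rfl; simp at hD
  rw [Finset.card_eq_two]
  refine ⟨r, -r, fun h => hr ?_, ?_⟩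
  · have : 2 * r = 0 := by linear_combination h
    exact (mul_eq_zero.1 this).resolve_left h2
  · ext u
    simp [← sq, sq_eq_sq_iff_eq_or_eq_neg]

open scoped Classical in
theorem card_sqrts_of_not_isSquare {D : F} (hs : ¬ IsSquare D) :
    Finset.card {u : F | u ^ 2 = D} = 0 := by
  rw [Finset.card_eq_zero, Finset.filter_eq_empty_iff]
  rintro u - rfl
  exact hs (IsSquare.sq u)

open scoped Classical in
/-- Completing the square in a quadratic equation, keeping track of the derivative. -/
theorem card_roots_quadratic (h2 : (2 : F) ≠ 0) {a : F} (ha : a ≠ 0) (β γ : F) (P : F → Prop)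
    [DecidablePred P] :
    Finset.card {t : F | a * t ^ 2 + β * t + γ = 0 ∧ P (2 * a * t + β)} =
      Finset.card {u : F | u ^ 2 = β ^ 2 - 4 * a * γ ∧ P u} := by
  have h2a : 2 * a ≠ 0 := mul_ne_zero h2 ha
  refine Finset.card_nbij' (fun t => 2 * a * t + β) (fun u => (u - β) / (2 * a)) ?_ ?_ ?_ ?_
  · intro t ht
    simp only [Finset.coe_filter, Finset.mem_univ, true_and, Set.mem_ofPred_eq] at ht ⊢
    exact ⟨by linear_combination 4 * a * ht.1, ht.2⟩
  · intro u hu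
    simp only [Finset.coe_filter, Finset.mem_univ, true_and, Set.mem_ofPred_eq] at hu ⊢
    have e : 2 * a * ((u - β) / (2 * a)) = u - β := mul_div_cancel₀ _ h2a
    refine ⟨?_, by rw [e, sub_add_cancel]; exact hu.2⟩
    have : 4 * a * (a * ((u - β) / (2 * a)) ^ 2 + β * ((u - β) / (2 * a)) + γ) = 0 := by
      linear_combination (2 * a * ((u - β) / (2 * a)) + (u - β) + 2 * β) * e + hu.1
    refine (mul_eq_zero.1 this).resolve_left (mul_ne_zero ?_ ha)
    have := mul_ne_zero h2 h2
    norm_num at this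
    exact this
  · intro t _
    field_simp
    ring
  · intro u _
    field_simp
    ring

open scoped Classical in
theorem card_roots_quadratic' (h2 : (2 : F) ≠ 0) {a : F} (ha : a ≠ 0) (β γ : F) :
    Finset.card {t : F | a * t ^ 2 + β * t + γ = 0} =
      Finset.card {u : F | u ^ 2 = β ^ 2 - 4 * a * γ} := by
  simpa using card_roots_quadratic h2 ha β γ (fun _ => True)

-- For t = 0 only s = 0 occurs. For each t ≠ 0 the equation is quadratic in s with discriminant
-- t²(β² − 4aγ), which has the same quadratic character for all t.
open scoped Classical in
theorem card_isotropic_of_card_sqrts (h2 : (2 : F) ≠ 0) {a : F} (ha : a ≠ 0) (β γ : F) {n : ℕ}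
    (hn : ∀ t : F, t ≠ 0 →
      Finset.card {u : F | u ^ 2 = t ^ 2 * (β ^ 2 - 4 * a * γ)} = n) :
    Finset.card {p : F × F | p.1 ^ 2 * a + p.1 * p.2 * β + p.2 ^ 2 * γ = 0} =
      1 + (Fintype.card F - 1) * n := by
  rw [card_filter_prod_right (fun s t : F => s ^ 2 * a + s * t * β + t ^ 2 * γ = 0),
    ← Finset.add_sum_erase _ _ (Finset.mem_univ (0 : F))]
  congr 1
  · rw [Finset.card_eq_one]
    exact ⟨0, by ext; simp [ha]⟩
  · rw [Finset.sum_congr rfl fun t ht => by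
      rw [show Finset.card {s : F | s ^ 2 * a + s * t * β + t ^ 2 * γ = 0} = n by
        rw [← hn t (Finset.ne_of_mem_erase ht),
          show t ^ 2 * (β ^ 2 - 4 * a * γ) = (t * β) ^ 2 - 4 * a * (t ^ 2 * γ) by ring,
          ← card_roots_quadratic' h2 ha]
        congr 1
        ext s
        simp only [Finset.mem_filter, Finset.mem_univ, true_and]
        ring_nf],
      Finset.sum_const, Finset.card_erase_of_mem (Finset.mem_univ _), Finset.card_univ, smul_eq_mul]

open scoped Classical in
theorem card_isotropic_of_disc_eq_zero (h2 : (2 : F) ≠ 0) {a : F} (ha : a ≠ 0) {β γ : F}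
    (hD : β ^ 2 - 4 * a * γ = 0) :
    (Finset.card {p : F × F | p.1 ^ 2 * a + p.1 * p.2 * β + p.2 ^ 2 * γ = 0} : ℤ) =
      Fintype.card F := by
  rw [card_isotropic_of_card_sqrts h2 ha β γ (n := 1) fun t _ => by
    rw [hD, mul_zero, card_sqrts_zero], mul_one, add_comm,
    Nat.sub_add_cancel Fintype.card_pos]

open scoped Classical in
theorem card_isotropic_of_isSquare_disc (h2 : (2 : F) ≠ 0) {a : F} (ha : a ≠ 0) {β γ : F}
    (hD : β ^ 2 - 4 * a * γ ≠ 0) (hs : IsSquare (β ^ 2 - 4 * a * γ)) :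
    (Finset.card {p : F × F | p.1 ^ 2 * a + p.1 * p.2 * β + p.2 ^ 2 * γ = 0} : ℤ) =
      2 * Fintype.card F - 1 := by
  rw [card_isotropic_of_card_sqrts h2 ha β γ (n := 2) fun t ht =>
    card_sqrts_of_isSquare h2 (mul_ne_zero (pow_ne_zero 2 ht) hD) ((IsSquare.sq t).mul hs)]
  have : 0 < Fintype.card F := Fintype.card_pos
  omega

open scoped Classical in
theorem card_isotropic_of_not_isSquare_disc (h2 : (2 : F) ≠ 0) {a : F} (ha : a ≠ 0) {β γ : F}
    (hs : ¬ IsSquare (β ^ 2 - 4 * a * γ)) :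
    (Finset.card {p : F × F | p.1 ^ 2 * a + p.1 * p.2 * β + p.2 ^ 2 * γ = 0} : ℤ) = 1 := by
  rw [card_isotropic_of_card_sqrts h2 ha β γ (n := 0) fun t ht =>
    card_sqrts_of_not_isSquare fun h => hs ?_, mul_zero, add_zero, Nat.cast_one]
  obtain ⟨r, hr⟩ := h
  exact ⟨r / t, by field_simp; linear_combination hr⟩

-- The form factors as t(sβ + tγ), a union of two distinct lines.
open scoped Classical in
theorem card_isotropic_linear {β : F} (hβ : β ≠ 0) (γ : F) :
    (Finset.card {p : F × F | p.1 * p.2 * β + p.2 ^ 2 * γ = 0} : ℤ) =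
      2 * Fintype.card F - 1 := by
  rw [card_filter_prod_right (fun s t : F => s * t * β + t ^ 2 * γ = 0),
    ← Finset.add_sum_erase _ _ (Finset.mem_univ (0 : F))]
  rw [Finset.sum_congr rfl fun t ht => by
      rw [show Finset.card {s : F | s * t * β + t ^ 2 * γ = 0} = 1 by
        have := Finset.ne_of_mem_erase ht
        rw [Finset.card_eq_one]
        refine ⟨-(t * γ) / β, ?_⟩
        ext s
        simp only [Finset.mem_filter, Finset.mem_univ, true_and, Finset.mem_singleton]
        rw [show s * t * β + t ^ 2 * γ = t * (s * β + t * γ) by ring, mul_eq_zero,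
          or_iff_right this, eq_div_iff hβ, eq_neg_iff_add_eq_zero]],
      Finset.sum_const, Finset.card_erase_of_mem (Finset.mem_univ _), Finset.card_univ, smul_eq_mul]
  have : 0 < Fintype.card F := Fintype.card_pos
  simp
  omega

open scoped Classical in
theorem card_isotropic_square {γ : F} (hγ : γ ≠ 0) :
    (Finset.card {p : F × F | p.2 ^ 2 * γ = 0} : ℤ) = Fintype.card F := by
  rw [card_filter_prod_right (fun _ t : F => t ^ 2 * γ = 0),
    ← Finset.add_sum_erase _ _ (Finset.mem_univ (0 : F)), Finset.sum_eq_zero]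
  · simp
  · intro t ht
    have := Finset.ne_of_mem_erase ht
    simp [this, hγ]

end FiniteFieldCounts

/-! ### Weights of codes given by an injective encoding -/

section CodeLemmas

theorem weightCount_range {F ι K : Type*} [Field F] [DecidableEq F] [Fintype ι] [AddCommGroup K]
    [Module F K] [Fintype K] {f : K →ₗ[F] (ι → F)} (hf : Function.Injective f) (i : ℕ) :
    weightCount (LinearMap.range f) i = Finset.card {b : K | hammingNorm (f b) = i} := by
  rw [weightCount, ← Set.ncard_coe_finset, ← Set.ncard_image_of_injective _ hf]
  congr 1
  ext c
  simp only [Set.mem_ofPred_eq, LinearMap.mem_range, Finset.coe_filter, Finset.mem_univ, true_and,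
    Set.mem_image]
  constructor
  · rintro ⟨⟨b, rfl⟩, h⟩
    exact ⟨b, h, rfl⟩
  · rintro ⟨b, h, rfl⟩
    exact ⟨⟨b, rfl⟩, h⟩

variable {F ι K : Type*} [Field F] [DecidableEq F] [Fintype ι] [AddCommGroup K] [Module F K]
  {f : K →ₗ[F] (ι → F)}

/-- The weight table of an encoding with finitely many classes of messages. -/
theorem hasWeightTable_range [Fintype K] {n : ℕ} (hf : Function.Injective f) (g : K → Fin n)
    (W : Fin n → ℤ)
    (hW : ∀ b, (hammingNorm (f b) : ℤ) = W (g b)) (N : Fin n → ℚ)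
    (hN : ∀ j, (Finset.card {b | g b = j} : ℚ) = N j) :
    HasWeightTable (LinearMap.range f) (List.ofFn fun j => (W j, N j)) := by
  intro i
  -- Classes of equal weight are added, so `W` need not be injective; this covers the case of
  -- coinciding rows.
  rw [weightCount_range hf, List.map_ofFn, List.sum_ofFn,
    card_filter_eq_sum_fibers g ({j | W j = i} : Finset (Fin n)) fun b => by
      rw [Finset.mem_filter, ← hW, Nat.cast_inj]
      simp, Finset.sum_filter]
  push_cast
  refine Finset.sum_congr rfl fun j _ => ?_
  simp [hN]

theorem isCode_range {n d : ℤ} {k : ℕ} (hf : Function.Injective f)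
    (hn : (Fintype.card ι : ℤ) = n) (hk : Module.finrank F K = k)
    (hmem : ∃ b, b ≠ 0 ∧ (hammingNorm (f b) : ℤ) = d)
    (hle : ∀ b, b ≠ 0 → d ≤ hammingNorm (f b)) : IsCode (LinearMap.range f) n k d := by
  refine ⟨hn, (LinearMap.finrank_range_of_inj hf).trans hk, ?_⟩
  obtain ⟨b, hb, hd⟩ := hmem
  refine ⟨_, hd, ⟨f b, ⟨b, rfl⟩, 0, Submodule.zero_mem _, ?_, hammingDist_zero_right _⟩, ?_⟩
  · rwa [Ne, map_eq_zero_iff f hf]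
  · rintro w ⟨_, ⟨x, rfl⟩, _, ⟨y, rfl⟩, hxy, rfl⟩
    rw [hammingDist_eq_hammingNorm, neg_add_eq_sub, ← map_sub]
    have := hle (y - x) (sub_ne_zero.2 fun h => hxy (h ▸ rfl))
    rw [← hd] at this
    exact_mod_cast this

theorem isWeightCode_range [Fintype K] (hf : Function.Injective f) {S : Finset ℤ}
    (hS : ∀ w, w ∈ S ↔ ∃ b, b ≠ 0 ∧ (hammingNorm (f b) : ℤ) = w) :
    IsWeightCode (LinearMap.range f) S.card := by
  classical
  rw [IsWeightCode, ← Set.ncard_coe_finset, ← Set.ncard_image_of_injective _ Nat.cast_injective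
    (β := ℤ)]
  congr 1
  ext w
  simp only [Set.mem_image, Set.mem_ofPred_eq, Finset.mem_coe, hS, weightCount_range hf, ne_eq,
    Finset.card_eq_zero, Finset.filter_eq_empty_iff, Finset.mem_univ, true_imp_iff, not_forall,
    not_not]
  constructor
  · rintro ⟨i, ⟨hi, b, rfl⟩, rfl⟩
    exact ⟨b, by rintro rfl; simp at hi, rfl⟩
  · rintro ⟨b, hb, rfl⟩
    refine ⟨_, ⟨hammingNorm_pos_iff.2 ?_, b, rfl⟩, rfl⟩
    rwa [Ne, map_eq_zero_iff f hf]

end CodeLemmas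

/-! ### Zeros of the form under one or two trace conditions -/

section ZeroCounts

theorem card_filter_eq_self {α : Type*} [Fintype α] (a : α) [DecidablePred fun x => x = a] :
    Finset.card {x | x = a} = 1 :=
  Finset.card_eq_one.2 ⟨a, by ext; simp⟩

theorem card_filter_sq_mul_eq_zero {F : Type*} [Field F] [Fintype F] {γ : F} (hγ : γ ≠ 0)
    [DecidablePred fun t : F => t ^ 2 * γ = 0] : Finset.card {t : F | t ^ 2 * γ = 0} = 1 :=
  Finset.card_eq_one.2 ⟨0, by ext; simp [hγ]⟩

theorem exists_polarMap_eq_and_normForm_eq_zero {F K : Type*} [Field F] [Field K]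
    [Algebra F K] (h2 : (2 : F) ≠ 0) {σ : K ≃ₐ[F] K} {v b : K}
    (hv : polarMap σ v = b) : (∃ c, polarMap σ c = b ∧ normForm σ c = 0) ↔ normForm σ v = 0 := by
  constructor
  · rintro ⟨c, hc, h0⟩
    rwa [normForm_eq_of_polarMap_eq h2 (hv.trans hc.symm)]
  · exact fun h => ⟨v, hv, h⟩

/-- The linear map `(s, t) ↦ s + t b`. -/
noncomputable def pencil (F : Type*) {K : Type*} [Field F] [Field K] [Algebra F K] (b : K) :
    F × F →ₗ[F] K :=
  (LinearMap.toSpanSingleton F K 1).coprod (LinearMap.toSpanSingleton F K b)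

theorem pencil_apply {F K : Type*} [Field F] [Field K] [Algebra F K] (b : K) (v : F × F) :
    pencil F b v = v.1 • 1 + v.2 • b := rfl

theorem pencil_eq_zero_iff {F K : Type*} [Field F] [Field K] [Algebra F K] {b : K}
    (hb : b ∉ Set.range (algebraMap F K)) (v : F × F) : pencil F b v = 0 ↔ v = 0 := by
  constructor
  · intro h
    rw [pencil_apply, ← Algebra.algebraMap_eq_smul_one, Algebra.smul_def] at h
    have ht : v.2 = 0 := by
      by_contra ht
      refine hb ⟨-(v.1 / v.2), ?_⟩
      have ht' := (map_ne_zero (algebraMap F K)).2 ht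
      rw [map_neg, map_div₀]
      field_simp
      linear_combination -h
    have hs : v.1 = 0 := by simpa [ht] using h
    exact Prod.ext hs ht
  · rintro rfl
    exact map_zero _

variable {F K : Type*} [Field F] [Fintype F] [Field K] [Fintype K] [Algebra F K]

/-- The Gauss sums of all nonzero multiples of `normForm σ` are equal to `-X`. -/
def HasGaussSum (σ : K ≃ₐ[F] K) (X : ℤ) : Prop :=
  ∃ χ : AddChar F ℂ, χ.IsPrimitive ∧
    ∀ z : F, z ≠ 0 → ∑ x : K, χ (z * normForm σ x) = -(X : ℂ)

open scoped Classical in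
/-- The number of zeros of `normForm σ` in the hyperplane `Tr (b x) = 0`. -/
noncomputable def zeroCount (σ : K ≃ₐ[F] K) (b : K) : ℕ :=
  Finset.card {x : K | normForm σ x = 0 ∧ Algebra.trace F K (b * x) = 0}

open scoped Classical in
/-- The number of zeros of `normForm σ` in the subspace `Tr x = Tr (b x) = 0`. -/
noncomputable def zeroCount₂ (σ : K ≃ₐ[F] K) (b : K) : ℕ :=
  Finset.card {x : K | normForm σ x = 0 ∧ Algebra.trace F K x = 0 ∧ Algebra.trace F K (b * x) = 0}

open scoped Classical in
theorem zeroCount_eq_card_annihilator (σ : K ≃ₐ[F] K) (b : K) :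
    zeroCount σ b = Finset.card {x : K | normForm σ x = 0 ∧
      ∀ t : F, Algebra.trace F K (LinearMap.toSpanSingleton F K b t * x) = 0} := by
  rw [zeroCount]
  congr 1
  ext x
  simp only [Finset.mem_filter, Finset.mem_univ, true_and, LinearMap.toSpanSingleton_apply,
    smul_mul_assoc, map_smul, smul_eq_mul]
  exact and_congr_right fun _ => ⟨fun h t => by rw [h, mul_zero], fun h => by simpa using h 1⟩

variable {σ : K ≃ₐ[F] K} {X : ℤ}

theorem zeroCount_zero (h2 : (2 : F) ≠ 0) (hX : HasGaussSum σ X) :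
    (Fintype.card F * zeroCount σ 0 : ℤ) = Fintype.card K - X * (Fintype.card F - 1) := by
  obtain ⟨χ, hχ, hS⟩ := hX
  have h := card_zeros_annihilator h2 hχ hS (LinearMap.toSpanSingleton F K 0)
  rw [← zeroCount_eq_card_annihilator] at h
  have hc : ∃ c, polarMap σ c = 0 ∧ normForm σ c = 0 := ⟨0, map_zero _, normForm_zero _⟩
  simp only [LinearMap.toSpanSingleton_apply, smul_zero, hc, Submodule.zero_mem,
    Finset.filter_true, Finset.card_univ] at h
  have hq : (Fintype.card F : ℤ) ≠ 0 := by exact_mod_cast Fintype.card_ne_zero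
  refine mul_left_cancel₀ hq ?_
  linear_combination h

theorem zeroCount_of_notMem (h2 : (2 : F) ≠ 0) (hX : HasGaussSum σ X) {b : K}
    (hb : b ∉ LinearMap.range (polarMap σ)) :
    (Fintype.card F ^ 2 * zeroCount σ b : ℤ) =
      Fintype.card K - X * (Fintype.card F - 1) := by
  classical
  obtain ⟨χ, hχ, hS⟩ := hX
  have h := card_zeros_annihilator h2 hχ hS (LinearMap.toSpanSingleton F K b)
  rw [← zeroCount_eq_card_annihilator] at h
  have hb0 : b ≠ 0 := fun h => hb (h ▸ Submodule.zero_mem _)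
  have hm : ∀ t : F, t • b ∈ LinearMap.range (polarMap σ) ↔ t = 0 := by
    intro t
    refine ⟨fun ht => ?_, ?_⟩
    · by_contra h0
      exact hb ((Submodule.smul_mem_iff _ h0).1 ht)
    · rintro rfl
      simp
  have he : ∀ t : F, (∃ c, polarMap σ c = t • b ∧ normForm σ c = 0) ↔ t = 0 := by
    intro t
    refine ⟨fun ⟨c, hc, _⟩ => (hm t).1 ⟨c, hc⟩, ?_⟩
    rintro rfl
    exact ⟨0, by simp, normForm_zero _⟩
  simp only [LinearMap.toSpanSingleton_apply, smul_eq_zero, hb0, or_false, hm, he,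
    card_filter_eq_self] at h
  push_cast at h
  linear_combination h

open scoped Classical in
theorem zeroCount_of_polarMap_aux (h2 : (2 : F) ≠ 0) (hX : HasGaussSum σ X) {c : K}
    (hc : polarMap σ c ≠ 0) :
    (Fintype.card F ^ 2 * zeroCount σ (polarMap σ c) : ℤ) =
      Fintype.card K - X * (Fintype.card F *
        Finset.card {t : F | t ^ 2 * normForm σ c = 0} - Fintype.card F) := by
  obtain ⟨χ, hχ, hS⟩ := hX
  have h := card_zeros_annihilator h2 hχ hS (LinearMap.toSpanSingleton F K (polarMap σ c))
  rw [← zeroCount_eq_card_annihilator] at h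
  have hm : ∀ t : F, t • polarMap σ c ∈ LinearMap.range (polarMap σ) :=
    fun t => Submodule.smul_mem _ _ ⟨c, rfl⟩
  have he : ∀ t : F, (∃ c', polarMap σ c' = t • polarMap σ c ∧ normForm σ c' = 0) ↔
      t ^ 2 * normForm σ c = 0 := by
    intro t
    rw [exists_polarMap_eq_and_normForm_eq_zero h2 (map_smul (polarMap σ) t c), normForm_smul]
  simp only [LinearMap.toSpanSingleton_apply, smul_eq_zero, hc, or_false, hm, he,
    card_filter_eq_self, Finset.filter_true,
    Finset.card_univ] at h
  push_cast at h
  linear_combination h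

theorem zeroCount_of_normForm_eq_zero (h2 : (2 : F) ≠ 0) (hX : HasGaussSum σ X) {c : K}
    (hc : polarMap σ c ≠ 0) (h0 : normForm σ c = 0) :
    (Fintype.card F ^ 2 * zeroCount σ (polarMap σ c) : ℤ) =
      Fintype.card K - X * (Fintype.card F ^ 2 - Fintype.card F) := by
  rw [zeroCount_of_polarMap_aux h2 hX hc]
  simp only [h0, mul_zero, Finset.filter_true, Finset.card_univ]
  ring

theorem zeroCount_of_normForm_ne_zero (h2 : (2 : F) ≠ 0) (hX : HasGaussSum σ X) {c : K}
    (hc : polarMap σ c ≠ 0) (h0 : normForm σ c ≠ 0) :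
    (Fintype.card F ^ 2 * zeroCount σ (polarMap σ c) : ℤ) = Fintype.card K := by
  classical
  rw [zeroCount_of_polarMap_aux h2 hX hc, card_filter_sq_mul_eq_zero h0]
  push_cast
  ring

open scoped Classical in
theorem zeroCount₂_eq_card_annihilator (σ : K ≃ₐ[F] K) (b : K) :
    zeroCount₂ σ b = Finset.card {x : K | normForm σ x = 0 ∧
      ∀ v : F × F, Algebra.trace F K (pencil F b v * x) = 0} := by
  rw [zeroCount₂]
  congr 1
  ext x
  simp only [Finset.mem_filter, Finset.mem_univ, true_and, pencil_apply, add_mul, map_add,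
    smul_mul_assoc, map_smul, smul_eq_mul, one_mul]
  exact and_congr_right fun _ => ⟨fun h v => by rw [h.1, h.2, mul_zero, mul_zero, add_zero],
    fun h => ⟨by simpa using h (1, 0), by simpa using h (0, 1)⟩⟩

-- Since 1 = L(h) lies in the image and b does not, s + tb lies in the image only for t = 0; there
-- its preimage sh has value s² Q(h).
open scoped Classical in
theorem zeroCount₂_of_notMem_aux (h2 : (2 : F) ≠ 0) (hX : HasGaussSum σ X) {h : K}
    (hh : polarMap σ h = 1) {b : K} (hb : b ∉ LinearMap.range (polarMap σ)) :
    (Fintype.card F ^ 3 * zeroCount₂ σ b : ℤ) =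
      Fintype.card K - X * (Fintype.card F * Finset.card {s : F | s ^ 2 * normForm σ h = 0} -
        Fintype.card F) := by
  obtain ⟨χ, hχ, hS⟩ := hX
  have hF : b ∉ Set.range (algebraMap F K) := by
    rintro ⟨s, rfl⟩
    exact hb ⟨s • h, by rw [map_smul, hh, Algebra.algebraMap_eq_smul_one]⟩
  have key := card_zeros_annihilator h2 hχ hS (pencil F b)
  rw [← zeroCount₂_eq_card_annihilator] at key
  have hm : ∀ v : F × F, pencil F b v ∈ LinearMap.range (polarMap σ) ↔ v.2 = 0 := by
    intro v
    rw [pencil_apply, Submodule.add_mem_iff_right _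
      (Submodule.smul_mem _ _ (show (1 : K) ∈ LinearMap.range (polarMap σ) from ⟨h, hh⟩))]
    refine ⟨fun ht => ?_, fun h0 => by simp [h0]⟩
    by_contra h0
    exact hb ((Submodule.smul_mem_iff _ h0).1 ht)
  have he : ∀ v : F × F, (∃ c, polarMap σ c = pencil F b v ∧ normForm σ c = 0) ↔
      v.1 ^ 2 * normForm σ h = 0 ∧ v.2 = 0 := by
    intro v
    by_cases hv : v.2 = 0
    · rw [exists_polarMap_eq_and_normForm_eq_zero h2 (v := v.1 • h)
        (by rw [map_smul, hh, pencil_apply, hv, zero_smul, add_zero]), normForm_smul]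
      simp [hv]
    · refine iff_of_false ?_ (fun h => hv h.2)
      rintro ⟨c, hc, _⟩
      exact hv ((hm v).1 ⟨c, hc⟩)
  have c1 : ∀ P : F → Prop, Finset.card {v : F × F | P v.1 ∧ v.2 = 0} =
      Finset.card {s : F | P s} := by
    intro P
    rw [show ({v : F × F | P v.1 ∧ v.2 = 0} : Finset (F × F)) =
      ({s : F | P s} : Finset F) ×ˢ {0} by ext ⟨s, t⟩; simp [eq_comm], Finset.card_product,
      Finset.card_singleton, mul_one]
  have c2 := c1 (fun _ => True)
  simp only [true_and, Finset.filter_true, Finset.card_univ] at c2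
  simp only [pencil_eq_zero_iff hF, hm, he, c1 (fun s => s ^ 2 * normForm σ h = 0), c2,
    card_filter_eq_self, Fintype.card_prod] at key
  push_cast at key
  linear_combination key

theorem zeroCount₂_of_notMem (h2 : (2 : F) ≠ 0) (hX : HasGaussSum σ X) {h : K}
    (hh : polarMap σ h = 1) (h0 : normForm σ h ≠ 0) {b : K}
    (hb : b ∉ LinearMap.range (polarMap σ)) :
    (Fintype.card F ^ 3 * zeroCount₂ σ b : ℤ) = Fintype.card K := by
  classical
  rw [zeroCount₂_of_notMem_aux h2 hX hh hb, card_filter_sq_mul_eq_zero h0]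
  push_cast
  ring

theorem zeroCount₂_of_notMem' (h2 : (2 : F) ≠ 0) (hX : HasGaussSum σ X) {h : K}
    (hh : polarMap σ h = 1) (h0 : normForm σ h = 0) {b : K}
    (hb : b ∉ LinearMap.range (polarMap σ)) :
    (Fintype.card F ^ 3 * zeroCount₂ σ b : ℤ) =
      Fintype.card K - X * (Fintype.card F ^ 2 - Fintype.card F) := by
  rw [zeroCount₂_of_notMem_aux h2 hX hh hb]
  simp only [h0, mul_zero, Finset.filter_true, Finset.card_univ]
  ring

-- The preimage of s + t L(c) is sh + tc, and the polar form of h and c is Tr(L(h)c) = Tr(c); the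
-- count is thus governed by a binary form in s and t.
open scoped Classical in
theorem zeroCount₂_polarMap (h2 : (2 : F) ≠ 0) (hX : HasGaussSum σ X) {h : K}
    (hh : polarMap σ h = 1) {c : K} (hc : polarMap σ c ∉ Set.range (algebraMap F K)) :
    (Fintype.card F ^ 3 * zeroCount₂ σ (polarMap σ c) : ℤ) =
      Fintype.card K - X * (Fintype.card F *
        Finset.card {p : F × F | p.1 ^ 2 * normForm σ h + p.1 * p.2 * Algebra.trace F K c +
          p.2 ^ 2 * normForm σ c = 0} - Fintype.card F ^ 2) := by
  obtain ⟨χ, hχ, hS⟩ := hX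
  have key := card_zeros_annihilator h2 hχ hS (pencil F (polarMap σ c))
  rw [← zeroCount₂_eq_card_annihilator] at key
  have hp : ∀ v : F × F, polarMap σ (v.1 • h + v.2 • c) = pencil F (polarMap σ c) v := by
    intro v
    rw [map_add, map_smul, map_smul, hh, pencil_apply]
  have hm : ∀ v : F × F, pencil F (polarMap σ c) v ∈ LinearMap.range (polarMap σ) :=
    fun v => ⟨_, hp v⟩
  have he : ∀ v : F × F, (∃ c', polarMap σ c' = pencil F (polarMap σ c) v ∧ normForm σ c' = 0) ↔
      v.1 ^ 2 * normForm σ h + v.1 * v.2 * Algebra.trace F K c + v.2 ^ 2 * normForm σ c = 0 := by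
    intro v
    rw [exists_polarMap_eq_and_normForm_eq_zero h2 (hp v), normForm_add, normForm_smul,
      normForm_smul, map_smul, hh, smul_mul_smul_comm, map_smul, one_mul, smul_eq_mul,
      add_right_comm]
  simp only [pencil_eq_zero_iff hc, hm, he, card_filter_eq_self,
    Fintype.card_prod, Finset.filter_true, Finset.card_univ] at key
  push_cast at key
  linear_combination key

end ZeroCounts

/-! ### Counting preimages by norm, trace and discriminant -/

section Frequencies

open scoped Classical in
theorem card_filter_comp_linearMap {F V W : Type*} [Field F] [AddCommGroup V] [Module F V]
    [AddCommGroup W] [Module F W] [Fintype V] [Fintype W] (L : V →ₗ[F] W) (P : W → Prop)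
    [DecidablePred P] :
    Finset.card {c | P (L c)} =
      Nat.card (LinearMap.ker L) * Finset.card {b | b ∈ LinearMap.range L ∧ P b} := by
  rw [Finset.card_eq_sum_card_fiberwise (f := L) (t := {b | b ∈ LinearMap.range L ∧ P b})
    (fun c hc => by simpa using hc), Finset.sum_const_nat (m := Nat.card (LinearMap.ker L)),
    mul_comm]
  intro b hb
  simp only [Finset.mem_filter, Finset.mem_univ, true_and] at hb
  obtain ⟨⟨c, rfl⟩, hP⟩ := hb
  rw [Nat.card_eq_fintype_card, Fintype.card_subtype]
  refine Finset.card_nbij' (fun x => x - c) (fun x => x + c) ?_ ?_ ?_ ?_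
  · intro x hx
    simp only [Finset.coe_filter, Finset.mem_filter, Finset.mem_univ, true_and,
      Set.mem_ofPred_eq] at hx
    simp [hx.2]
  · intro x hx
    simp only [Finset.coe_filter, Finset.mem_univ, true_and, Set.mem_ofPred_eq,
      LinearMap.mem_ker] at hx
    simp [hx, hP]
  · exact fun x _ => sub_add_cancel x c
  · exact fun x _ => add_sub_cancel_right x c

/-- By self-adjointness Tr(x) = Tr(x L(h)) = Tr(L(x) h). So the trace of a preimage, like its norm
form, depends only on the message. -/
theorem trace_eq_of_polarMap_eq {F K : Type*} [Field F] [Field K] [Algebra F K] {σ : K ≃ₐ[F] K}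
    {h : K} (hh : polarMap σ h = 1) {x y : K} (hxy : polarMap σ x = polarMap σ y) :
    Algebra.trace F K x = Algebra.trace F K y := by
  rw [← mul_one x, ← mul_one y, ← hh, trace_mul_polarMap, trace_mul_polarMap, hxy]

theorem trace_eq_two_mul_normForm {F K : Type*} [Field F] [Field K] [Algebra F K]
    {σ : K ≃ₐ[F] K} {h : K} (hh : polarMap σ h = 1) :
    Algebra.trace F K h = 2 * normForm σ h := by
  rw [two_mul_normForm, hh, one_mul]

open scoped Classical in
theorem zeroCount_zero_eq_add {F K : Type*} [Field F] [Field K] [Fintype K] [Algebra F K]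
    (σ : K ≃ₐ[F] K) :
    zeroCount σ 0 = zeroCount σ 1 +
      Finset.card {x : K | normForm σ x = 0 ∧ Algebra.trace F K x ≠ 0} := by
  rw [zeroCount, zeroCount, ← Finset.card_filter_add_card_filter_not
    (s := {x : K | normForm σ x = 0 ∧ Algebra.trace F K (0 * x) = 0})
    (fun x => Algebra.trace F K x = 0), Finset.filter_filter, Finset.filter_filter]
  simp

variable {F K : Type*} [Field F] [Fintype F] [Field K] [Fintype K] [Algebra F K] {σ : K ≃ₐ[F] K}

theorem sum_card_translates (h : K) (P : K → Prop) [DecidablePred P] :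
    ∑ c : K, Finset.card {t : F | P (t • h + c)} =
      Fintype.card F * Finset.card {c | P c} := by
  simp only [Finset.card_filter]
  have ht : ∀ t : F, ∑ c : K, (if P (t • h + c) then 1 else 0) = ∑ c : K, if P c then 1 else 0 :=
    fun t => Equiv.sum_comp (Equiv.addLeft (t • h)) (fun c => if P c then 1 else 0)
  rw [Finset.sum_comm]
  simp only [ht, Finset.sum_const, Finset.card_univ, smul_eq_mul]

-- The discriminant is that of the quadratic t ↦ Q(th + c), whose derivative 2Q(h)t + Tr(c) equals
-- Tr(th + c). Square roots of the discriminant thus correspond to isotropic translates th + c, and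
-- each vector is such a translate of q vectors c.
open scoped Classical in
theorem sum_card_sqrts_disc (h2 : (2 : F) ≠ 0) {h : K} (hh : polarMap σ h = 1)
    (h0 : normForm σ h ≠ 0) (R : F → Prop) [DecidablePred R] :
    ∑ c : K, Finset.card {u : F | u ^ 2 =
      Algebra.trace F K c ^ 2 - 4 * normForm σ h * normForm σ c ∧ R u} =
    Fintype.card F * Finset.card {c : K | normForm σ c = 0 ∧ R (Algebra.trace F K c)} := by
  rw [← sum_card_translates h (fun c => normForm σ c = 0 ∧ R (Algebra.trace F K c))]
  refine Finset.sum_congr rfl fun c _ => ?_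
  rw [← card_roots_quadratic h2 h0]
  congr 1
  ext t
  simp only [Finset.mem_filter, Finset.mem_univ, true_and]
  rw [normForm_add, normForm_smul, map_smul, hh, smul_mul_assoc, one_mul, map_smul, smul_eq_mul,
    map_add, map_smul, smul_eq_mul, trace_eq_two_mul_normForm hh]
  ring_nf

open scoped Classical in
theorem card_disc_eq_zero (h2 : (2 : F) ≠ 0) {h : K} (hh : polarMap σ h = 1)
    (h0 : normForm σ h ≠ 0) :
    Finset.card {c : K | Algebra.trace F K c ^ 2 - 4 * normForm σ h * normForm σ c = 0} =
      Fintype.card F * zeroCount σ 1 := by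
  have := sum_card_sqrts_disc h2 hh h0 (fun u => u = 0)
  simp only [zeroCount, one_mul]
  rw [← this, Finset.card_filter]
  refine Finset.sum_congr rfl fun c _ => ?_
  split_ifs with hc
  · rw [hc, eq_comm, Finset.card_eq_one]
    exact ⟨0, by ext; simp⟩
  · rw [eq_comm, Finset.card_eq_zero, Finset.filter_eq_empty_iff]
    rintro u - ⟨hu, rfl⟩
    exact hc (by rw [← hu]; ring)

open scoped Classical in
theorem two_mul_card_isSquare_disc (h2 : (2 : F) ≠ 0) {h : K} (hh : polarMap σ h = 1)
    (h0 : normForm σ h ≠ 0) :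
    2 * Finset.card {c : K | Algebra.trace F K c ^ 2 - 4 * normForm σ h * normForm σ c ≠ 0 ∧
      IsSquare (Algebra.trace F K c ^ 2 - 4 * normForm σ h * normForm σ c)} =
    Fintype.card F * Finset.card {x : K | normForm σ x = 0 ∧ Algebra.trace F K x ≠ 0} := by
  refine Eq.trans ?_ ((sum_card_sqrts_disc h2 hh h0 (fun u => u ≠ 0)).trans rfl)
  rw [Finset.card_filter, Finset.mul_sum]
  refine Finset.sum_congr rfl fun c _ => ?_
  split_ifs with hc
  · refine (mul_one 2).trans ((card_sqrts_of_isSquare h2 hc.1 hc.2).symm.trans ?_)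
    congr 1
    ext u
    simp only [Finset.mem_filter, Finset.mem_univ, true_and, iff_self_and]
    rintro hu rfl
    exact hc.1 (by rw [← hu]; ring)
  · rw [mul_zero, eq_comm, Finset.card_eq_zero, Finset.filter_eq_empty_iff]
    rintro u - ⟨hu, hu0⟩
    exact hc ⟨by rw [← hu]; exact pow_ne_zero 2 hu0, by rw [← hu]; exact IsSquare.sq u⟩

open scoped Classical in
theorem mul_card_trace_ne_zero :
    (Fintype.card F * Finset.card {c : K | Algebra.trace F K c ≠ 0} : ℤ) =
      (Fintype.card F - 1) * Fintype.card K := by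
  have hr : LinearMap.range (Algebra.trace F K) = ⊤ :=
    LinearMap.range_eq_top.2 (Algebra.trace_surjective F K)
  have h1 := card_filter_comp_linearMap (Algebra.trace F K) (fun _ => True)
  have h3 := card_filter_comp_linearMap (Algebra.trace F K) (fun a => a ≠ 0)
  simp only [hr, Submodule.mem_top, true_and, Finset.filter_true, Finset.card_univ] at h1 h3
  rw [Finset.filter_ne', Finset.card_erase_of_mem (Finset.mem_univ _), Finset.card_univ] at h3
  have h4 : ((Fintype.card F - 1 : ℕ) : ℤ) = Fintype.card F - 1 := by
    rw [Nat.cast_sub Fintype.card_pos, Nat.cast_one]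
  rw [h1, h3]
  push_cast [h4]
  ring

end Frequencies

/-! ### Weights as combinations of zero counts -/

section Weights

/-- The weight of the codeword of `b` in the code whose defining set consists of the zeros of
`normForm σ` with nonzero trace. -/
noncomputable def codeWeight {F K : Type*} [Field F] [Field K] [Fintype K]
    [Algebra F K] (σ : K ≃ₐ[F] K) (b : K) : ℤ :=
  zeroCount σ 0 - zeroCount σ 1 - zeroCount σ b + zeroCount₂ σ b

theorem codeWeight_zero {F K : Type*} [Field F] [Field K] [Fintype K] [Algebra F K]
    (σ : K ≃ₐ[F] K) : codeWeight σ 0 = 0 := by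
  have : zeroCount₂ σ 0 = zeroCount σ 1 := by
    classical
    simp [zeroCount, zeroCount₂]
  rw [codeWeight, this]
  ring

theorem codeWeight_algebraMap {F K : Type*} [Field F] [Field K] [Fintype K] [Algebra F K]
    (σ : K ≃ₐ[F] K) {s : F} (hs : s ≠ 0) :
    codeWeight σ (algebraMap F K s) = zeroCount σ 0 - zeroCount σ 1 := by
  classical
  have h1 : zeroCount σ (algebraMap F K s) = zeroCount σ 1 := by
    simp [zeroCount, ← Algebra.smul_def, hs]
  have h2 : zeroCount₂ σ (algebraMap F K s) = zeroCount σ 1 := by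
    simp [zeroCount, zeroCount₂, ← Algebra.smul_def, hs]
  rw [codeWeight, h1, h2]
  ring

variable {F K : Type*} [Field F] [Fintype F] [Field K] [Fintype K] [Algebra F K] {σ : K ≃ₐ[F] K}
  {X u x : ℤ}

theorem zeroCount_zero_eq (h2 : (2 : F) ≠ 0) (hX : HasGaussSum σ X)
    (hM : (Fintype.card K : ℤ) = Fintype.card F ^ 3 * u) (hx : X = Fintype.card F ^ 2 * x) :
    (zeroCount σ 0 : ℤ) =
      Fintype.card F ^ 2 * u - Fintype.card F * (Fintype.card F - 1) * x := by
  have hq : (Fintype.card F : ℤ) ≠ 0 := by exact_mod_cast Fintype.card_ne_zero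
  refine mul_left_cancel₀ hq ?_
  rw [zeroCount_zero h2 hX, hM, hx]
  ring

theorem zeroCount_one_of_ne_zero (h2 : (2 : F) ≠ 0) (hX : HasGaussSum σ X)
    (hM : (Fintype.card K : ℤ) = Fintype.card F ^ 3 * u) {h : K} (hh : polarMap σ h = 1)
    (h0 : normForm σ h ≠ 0) : (zeroCount σ 1 : ℤ) = Fintype.card F * u := by
  have hq : (Fintype.card F : ℤ) ^ 2 ≠ 0 := pow_ne_zero 2 (by exact_mod_cast Fintype.card_ne_zero)
  refine mul_left_cancel₀ hq ?_
  have := zeroCount_of_normForm_ne_zero h2 hX (c := h) (by rw [hh]; exact one_ne_zero) h0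
  rw [hh] at this
  rw [this, hM]
  ring

theorem zeroCount_one_of_eq_zero (h2 : (2 : F) ≠ 0) (hX : HasGaussSum σ X)
    (hM : (Fintype.card K : ℤ) = Fintype.card F ^ 3 * u) (hx : X = Fintype.card F ^ 2 * x)
    {h : K} (hh : polarMap σ h = 1) (h0 : normForm σ h = 0) :
    (zeroCount σ 1 : ℤ) = Fintype.card F * u - Fintype.card F * (Fintype.card F - 1) * x := by
  have hq : (Fintype.card F : ℤ) ^ 2 ≠ 0 := pow_ne_zero 2 (by exact_mod_cast Fintype.card_ne_zero)
  refine mul_left_cancel₀ hq ?_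
  have := zeroCount_of_normForm_eq_zero h2 hX (c := h) (by rw [hh]; exact one_ne_zero) h0
  rw [hh] at this
  rw [this, hM, hx]
  ring

/-- The counts under one and two conditions are available multiplied by q² and q³, so weights are
identified after clearing q³. -/
theorem codeWeight_eq_of_cube_mul {b : K} {w : ℤ}
    (hw : (Fintype.card F : ℤ) ^ 3 * w = Fintype.card F ^ 3 * zeroCount σ 0 -
      Fintype.card F ^ 3 * zeroCount σ 1 - Fintype.card F * (Fintype.card F ^ 2 * zeroCount σ b) +
      Fintype.card F ^ 3 * zeroCount₂ σ b) : codeWeight σ b = w := by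
  have hq : (Fintype.card F : ℤ) ^ 3 ≠ 0 := pow_ne_zero 3 (by exact_mod_cast Fintype.card_ne_zero)
  refine mul_left_cancel₀ hq ?_
  rw [hw, codeWeight]
  ring

end Weights

/-! ### Classes of messages when Q(h) ≠ 0 -/

section Classes

theorem exists_preimages {F K : Type*} [Field F] [Field K] [Algebra F K] (σ : K ≃ₐ[F] K) :
    ∃ pre : K → K, ∀ b ∈ LinearMap.range (polarMap σ), polarMap σ (pre b) = b := by
  classical
  exact ⟨fun b => if hb : b ∈ LinearMap.range (polarMap σ) then hb.choose else 0,
    fun b hb => by simp only [dif_pos hb]; exact hb.choose_spec⟩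

theorem algebraMap_mem_range_polarMap {F K : Type*} [Field F] [Field K] [Algebra F K]
    {σ : K ≃ₐ[F] K} {h : K} (hh : polarMap σ h = 1) (s : F) :
    polarMap σ (s • h) = algebraMap F K s := by
  rw [map_smul, hh, Algebra.algebraMap_eq_smul_one]

/-- Norm form and trace are constant on the fibres of the polar map, which all have the order of its
kernel. This converts counts of preimages into class sizes. -/
theorem card_filter_normForm_trace {F K : Type*} [Field F] [Field K] [Fintype K] [Algebra F K]
    {σ : K ≃ₐ[F] K} (h2 : (2 : F) ≠ 0) {h : K} (hh : polarMap σ h = 1)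
    {pre : K → K} (hpre : ∀ b ∈ LinearMap.range (polarMap σ), polarMap σ (pre b) = b)
    (R : F → F → Prop) [∀ y t, Decidable (R y t)] {n : ℕ} (g : K → Fin n) (J : Finset (Fin n))
    (hJ : ∀ b, b ∈ LinearMap.range (polarMap σ) ∧
      R (normForm σ (pre b)) (Algebra.trace F K (pre b)) ↔ g b ∈ J) :
    Finset.card {c : K | R (normForm σ c) (Algebra.trace F K c)} =
      Nat.card (LinearMap.ker (polarMap σ)) * ∑ j ∈ J, Finset.card {b | g b = j} := by
  classical
  rw [← card_filter_eq_sum_fibers g J hJ, ← card_filter_comp_linearMap (polarMap σ)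
    (fun b => R (normForm σ (pre b)) (Algebra.trace F K (pre b)))]
  congr 1
  ext c
  have := hpre _ ⟨c, rfl⟩
  simp only [Finset.mem_filter, Finset.mem_univ, true_and, normForm_eq_of_polarMap_eq h2 this,
    trace_eq_of_polarMap_eq hh this]

open scoped Classical in
/-- The index of the class of a message with given properties, when the Gram matrix of the form on
the constants is nonzero. -/
noncomputable def classIndex (p0 pF pR pQ pT pD pS : Prop) : Fin 7 :=
  if p0 then 0 else if pF then 1 else if pR then
    if pQ then if pT then 2 else 3 else if pD then 4 else if pS then 5 else 6
  else 6

theorem classIndex_eq_zero_iff {p0 pF pR pQ pT pD pS : Prop} :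
    classIndex p0 pF pR pQ pT pD pS = 0 ↔ p0 := by
  by_cases p0 <;> by_cases pF <;> by_cases pR <;> by_cases pQ <;> by_cases pT <;> by_cases pD <;>
    by_cases pS <;> simp_all [classIndex]

theorem classIndex_eq_one_iff {p0 pF pR pQ pT pD pS : Prop} :
    classIndex p0 pF pR pQ pT pD pS = 1 ↔ ¬ p0 ∧ pF := by
  by_cases p0 <;> by_cases pF <;> by_cases pR <;> by_cases pQ <;> by_cases pT <;> by_cases pD <;>
    by_cases pS <;> simp_all [classIndex]

/-- Zero and the nonzero constants are split off first but still satisfy some of the conditions on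
norm, trace and discriminant. The hypotheses record which, so each counted condition becomes a union
of classes. -/
theorem classIndex_mem {p0 pF pR pQ pT pD pS : Prop} (h0 : p0 → pR ∧ pQ ∧ pT)
    (h1 : ¬ p0 → pF → pR ∧ ¬ pQ ∧ pD) (h2 : pQ → pS ∧ (pD ↔ pT)) :
    (pR ∧ pQ ∧ pT ↔ classIndex p0 pF pR pQ pT pD pS ∈ ({0, 2} : Finset (Fin 7))) ∧
    (pR ∧ pQ ∧ ¬ pT ↔ classIndex p0 pF pR pQ pT pD pS ∈ ({3} : Finset (Fin 7))) ∧
    (pR ∧ pD ↔ classIndex p0 pF pR pQ pT pD pS ∈ ({0, 1, 2, 4} : Finset (Fin 7))) ∧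
    (pR ∧ ¬ pD ∧ pS ↔ classIndex p0 pF pR pQ pT pD pS ∈ ({3, 5} : Finset (Fin 7))) := by
  by_cases p0 <;> by_cases pF <;> by_cases pR <;> by_cases pQ <;> by_cases pT <;> by_cases pD <;>
    by_cases pS <;> simp_all [classIndex]

variable {F K : Type*} [Field F] [Fintype F] [Field K] [Fintype K] [Algebra F K] {σ : K ≃ₐ[F] K}
  {X u x : ℤ}

theorem codeWeight_of_notMem_of_ne_zero (h2 : (2 : F) ≠ 0) (hX : HasGaussSum σ X)
    (hM : (Fintype.card K : ℤ) = Fintype.card F ^ 3 * u) (hx : X = Fintype.card F ^ 2 * x)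
    {h : K} (hh : polarMap σ h = 1) (h0 : normForm σ h ≠ 0) {b : K}
    (hb : b ∉ LinearMap.range (polarMap σ)) :
    codeWeight σ b = (Fintype.card F - 1) ^ 2 * (u - x) := by
  refine codeWeight_eq_of_cube_mul ?_
  rw [zeroCount_zero_eq h2 hX hM hx, zeroCount_one_of_ne_zero h2 hX hM hh h0,
    zeroCount_of_notMem h2 hX hb, zeroCount₂_of_notMem h2 hX hh h0 hb, hM, hx]
  ring

theorem codeWeight_of_notMem_of_eq_zero (h2 : (2 : F) ≠ 0) (hX : HasGaussSum σ X)
    (hM : (Fintype.card K : ℤ) = Fintype.card F ^ 3 * u) (hx : X = Fintype.card F ^ 2 * x)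
    {h : K} (hh : polarMap σ h = 1) (h0 : normForm σ h = 0) {b : K}
    (hb : b ∉ LinearMap.range (polarMap σ)) :
    codeWeight σ b = (Fintype.card F - 1) * (Fintype.card F * u - u) := by
  refine codeWeight_eq_of_cube_mul ?_
  rw [zeroCount_zero_eq h2 hX hM hx, zeroCount_one_of_eq_zero h2 hX hM hx hh h0,
    zeroCount_of_notMem h2 hX hb, zeroCount₂_of_notMem' h2 hX hh h0 hb, hM, hx]
  ring

-- Besides N(b), which depends on whether Q(c) vanishes, the only input is the number `n` of zeros
-- of the binary form, which gives N(1, b). The scaling is |K| = q³u and X = q²x.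
open scoped Classical in
theorem codeWeight_polarMap_of_normForm_eq_zero (h2 : (2 : F) ≠ 0) (hX : HasGaussSum σ X)
    (hM : (Fintype.card K : ℤ) = Fintype.card F ^ 3 * u) (hx : X = Fintype.card F ^ 2 * x)
    {h : K} (hh : polarMap σ h = 1) {c : K} (hc : polarMap σ c ∉ Set.range (algebraMap F K))
    (hQ : normForm σ c = 0) {w n : ℤ}
    (hn : (Finset.card {p : F × F | p.1 ^ 2 * normForm σ h + p.1 * p.2 * Algebra.trace F K c +
          p.2 ^ 2 * normForm σ c = 0} : ℤ) = n)
    (hw : w = zeroCount σ 0 - zeroCount σ 1 - Fintype.card F * u +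
      Fintype.card F * (Fintype.card F - 1) * x + u - x * (n - Fintype.card F)) :
    codeWeight σ (polarMap σ c) = w := by
  have hc0 : polarMap σ c ≠ 0 := fun h => hc ⟨0, by rw [h, map_zero]⟩
  refine codeWeight_eq_of_cube_mul ?_
  rw [zeroCount_of_normForm_eq_zero h2 hX hc0 hQ, zeroCount₂_polarMap h2 hX hh hc, hn, hM, hx]
  linear_combination (Fintype.card F : ℤ) ^ 3 * hw

open scoped Classical in
theorem codeWeight_polarMap_of_normForm_ne_zero (h2 : (2 : F) ≠ 0) (hX : HasGaussSum σ X)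
    (hM : (Fintype.card K : ℤ) = Fintype.card F ^ 3 * u) (hx : X = Fintype.card F ^ 2 * x)
    {h : K} (hh : polarMap σ h = 1) {c : K} (hc : polarMap σ c ∉ Set.range (algebraMap F K))
    (hQ : normForm σ c ≠ 0) {w n : ℤ}
    (hn : (Finset.card {p : F × F | p.1 ^ 2 * normForm σ h + p.1 * p.2 * Algebra.trace F K c +
          p.2 ^ 2 * normForm σ c = 0} : ℤ) = n)
    (hw : w = zeroCount σ 0 - zeroCount σ 1 - Fintype.card F * u + u -
      x * (n - Fintype.card F)) :
    codeWeight σ (polarMap σ c) = w := by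
  have hc0 : polarMap σ c ≠ 0 := fun h => hc ⟨0, by rw [h, map_zero]⟩
  refine codeWeight_eq_of_cube_mul ?_
  rw [zeroCount_of_normForm_ne_zero h2 hX hc0 hQ, zeroCount₂_polarMap h2 hX hh hc, hn, hM, hx]
  linear_combination (Fintype.card F : ℤ) ^ 3 * hw

open scoped Classical in
theorem card_algebraMap_ne_zero :
    (Finset.card {b : K | b ≠ 0 ∧ b ∈ Set.range (algebraMap F K)} : ℤ) = Fintype.card F - 1 := by
  have : ({b : K | b ≠ 0 ∧ b ∈ Set.range (algebraMap F K)} : Finset K) =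
      (Finset.univ.erase (0 : F)).image (algebraMap F K) := by
    ext b
    simp only [Finset.mem_filter, Finset.mem_univ, true_and, Finset.mem_image, Finset.mem_erase,
      and_true, Set.mem_range]
    constructor
    · rintro ⟨h0, s, rfl⟩
      exact ⟨s, fun h => h0 (by rw [h, map_zero]), rfl⟩
    · rintro ⟨s, h0, rfl⟩
      exact ⟨(map_ne_zero _).2 h0, s, rfl⟩
  rw [this, Finset.card_image_of_injective _ (algebraMap F K).injective,
    Finset.card_erase_of_mem (Finset.mem_univ _), Finset.card_univ, Nat.cast_sub Fintype.card_pos,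
    Nat.cast_one]

/-- The equations carrying `w` count preimages c with, in turn, Q = Tr = 0; Q = 0 ≠ Tr; discriminant
zero; discriminant a nonzero square. Together with the total they determine all class sizes. -/
theorem exists_classes_of_ne_zero (h2 : (2 : F) ≠ 0) (hX : HasGaussSum σ X)
    (hM : (Fintype.card K : ℤ) = Fintype.card F ^ 3 * u) (hx : X = Fintype.card F ^ 2 * x)
    {h : K} (hh : polarMap σ h = 1) (h0 : normForm σ h ≠ 0) {q : ℤ} (hq : (Fintype.card F : ℤ) = q)
    {w : ℤ} (hw : (Nat.card (LinearMap.ker (polarMap σ)) : ℤ) = w) :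
    ∃ (g : K → Fin 7) (f : Fin 7 → ℤ), (∀ b, g b = 0 ↔ b = 0) ∧
      (∀ b, codeWeight σ b = ![0, (q - 1) * (q * u - q * x), (q - 1) * (q * u - u),
        (q - 1) * (q * u - u - x), (q - 1) * (q * u - u - q * x), (q - 1) * (q * u - u - q * x - x),
        (q - 1) ^ 2 * (u - x)] (g b)) ∧
      (∀ j, (Finset.card {b | g b = j} : ℤ) = f j) ∧ f 0 = 1 ∧ f 1 = q - 1 ∧
      w * (f 0 + f 2) = q * u ∧ w * f 3 = q * (q - 1) * (u - x) ∧
      w * (f 0 + f 1 + f 2 + f 4) = q ^ 2 * u ∧ 2 * (w * (f 3 + f 5)) = q ^ 2 * (q - 1) * (u - x) ∧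
      f 0 + f 1 + f 2 + f 3 + f 4 + f 5 + f 6 = q ^ 3 * u := by
  classical
  obtain ⟨pre, hpre⟩ := exists_preimages σ
  set D : K → F := fun c => Algebra.trace F K c ^ 2 - 4 * normForm σ h * normForm σ c with hD
  set g : K → Fin 7 := fun b => classIndex (b = 0) (b ∈ Set.range (algebraMap F K))
    (b ∈ LinearMap.range (polarMap σ)) (normForm σ (pre b) = 0) (Algebra.trace F K (pre b) = 0)
    (D (pre b) = 0) (IsSquare (D (pre b))) with hg
  have hN0 := zeroCount_zero_eq h2 hX hM hx
  have hN1 := zeroCount_one_of_ne_zero h2 hX hM hh h0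
  have hF : ∀ s : F, algebraMap F K s ∈ LinearMap.range (polarMap σ) ∧
      normForm σ (pre (algebraMap F K s)) = s ^ 2 * normForm σ h ∧
      Algebra.trace F K (pre (algebraMap F K s)) = s * (2 * normForm σ h) := by
    intro s
    have hs := algebraMap_mem_range_polarMap hh s
    have hmem : algebraMap F K s ∈ LinearMap.range (polarMap σ) := ⟨_, hs⟩
    have e := (hpre _ hmem).trans hs.symm
    refine ⟨hmem, ?_, ?_⟩
    · rw [normForm_eq_of_polarMap_eq h2 e, normForm_smul]
    · rw [trace_eq_of_polarMap_eq hh e, map_smul, smul_eq_mul, trace_eq_two_mul_normForm hh]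
  have hF0 : ∀ b : K, b = 0 → b ∈ LinearMap.range (polarMap σ) ∧ normForm σ (pre b) = 0 ∧
      Algebra.trace F K (pre b) = 0 := by
    rintro b rfl
    simpa using hF 0
  have hF1 : ∀ b : K, b ≠ 0 → b ∈ Set.range (algebraMap F K) →
      b ∈ LinearMap.range (polarMap σ) ∧ normForm σ (pre b) ≠ 0 ∧ D (pre b) = 0 := by
    rintro _ hb ⟨s, rfl⟩
    obtain ⟨h1, h3, h4⟩ := hF s
    have hs : s ≠ 0 := fun h => hb (by rw [h, map_zero])
    refine ⟨h1, by rw [h3]; exact mul_ne_zero (pow_ne_zero 2 hs) h0, ?_⟩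
    simp only [hD, h3, h4]
    ring
  have hDQ : ∀ c : K, normForm σ c = 0 →
      IsSquare (D c) ∧ (D c = 0 ↔ Algebra.trace F K c = 0) := by
    intro c hc
    simp only [hD, hc, mul_zero, sub_zero]
    exact ⟨IsSquare.sq _, pow_eq_zero_iff two_ne_zero⟩
  have hg0 : ∀ b, g b = 0 ↔ b = 0 :=
    fun b => classIndex_eq_zero_iff
  have hg1 : ∀ b, g b = 1 ↔ b ≠ 0 ∧ b ∈ Set.range (algebraMap F K) :=
    fun b => classIndex_eq_one_iff
  have hcls := fun b => classIndex_mem (hF0 b) (hF1 b) (hDQ (pre b))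
  refine ⟨g, fun j => (Finset.card {b | g b = j} : ℤ), hg0, ?_, fun j => rfl, ?_, ?_, ?_, ?_, ?_,
    ?_, ?_⟩
  · intro b
    by_cases hb0 : b = 0
    · rw [(hg0 b).2 hb0, hb0, codeWeight_zero]
      rfl
    by_cases hbF : b ∈ Set.range (algebraMap F K)
    · rw [(hg1 b).2 ⟨hb0, hbF⟩]
      obtain ⟨s, rfl⟩ := hbF
      rw [codeWeight_algebraMap σ (fun h => hb0 (by rw [h, map_zero])), hN0, hN1, hq]
      simp only [Matrix.cons_val_one, Matrix.cons_val_zero]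
      ring
    by_cases hbR : b ∈ LinearMap.range (polarMap σ)
    · have hpb := hpre b hbR
      have hpF : polarMap σ (pre b) ∉ Set.range (algebraMap F K) := by rwa [hpb]
      by_cases hQ : normForm σ (pre b) = 0
      · by_cases hT : Algebra.trace F K (pre b) = 0
        · have : g b = 2 := by
              simp only [hg, classIndex, if_true, if_false, hb0, hbF, hbR, hQ, hT]
          rw [this, ← hpb]
          refine codeWeight_polarMap_of_normForm_eq_zero h2 hX hM hx hh hpF hQ
            (card_isotropic_of_disc_eq_zero h2 h0 ((hDQ _ hQ).2.2 hT)) ?_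
          rw [hN0, hN1, hq]
          simp
          ring
        · have : g b = 3 := by
              simp only [hg, classIndex, if_true, if_false, hb0, hbF, hbR, hQ, hT]
          rw [this, ← hpb]
          refine codeWeight_polarMap_of_normForm_eq_zero h2 hX hM hx hh hpF hQ
            (card_isotropic_of_isSquare_disc h2 h0 (fun h => hT ((hDQ _ hQ).2.1 h)) (hDQ _ hQ).1) ?_
          rw [hN0, hN1, hq]
          simp
          ring
      · by_cases hd : D (pre b) = 0
        · have : g b = 4 := by
              simp only [hg, classIndex, if_true, if_false, hb0, hbF, hbR, hQ, hd]
          rw [this, ← hpb]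
          refine codeWeight_polarMap_of_normForm_ne_zero h2 hX hM hx hh hpF hQ
            (card_isotropic_of_disc_eq_zero h2 h0 hd) ?_
          rw [hN0, hN1, hq]
          simp
          ring
        · by_cases hs : IsSquare (D (pre b))
          · have : g b = 5 := by
              simp only [hg, classIndex, if_true, if_false, hb0, hbF, hbR, hQ, hd, hs]
            rw [this, ← hpb]
            refine codeWeight_polarMap_of_normForm_ne_zero h2 hX hM hx hh hpF hQ
              (card_isotropic_of_isSquare_disc h2 h0 hd hs) ?_
            rw [hN0, hN1, hq]
            simp
            ring
          · have : g b = 6 := by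
              simp only [hg, classIndex, if_true, if_false, hb0, hbF, hbR, hQ, hd, hs]
            rw [this, ← hpb]
            refine codeWeight_polarMap_of_normForm_ne_zero h2 hX hM hx hh hpF hQ
              (card_isotropic_of_not_isSquare_disc h2 h0 hs) ?_
            rw [hN0, hN1, hq]
            simp
            ring
    -- Outside the image the weight agrees with that for a nonsquare discriminant, so both kinds of
    -- message share a class.
    · have : g b = 6 := by
        simp only [hg, classIndex, if_false, hb0, hbF, hbR]
      rw [this, codeWeight_of_notMem_of_ne_zero h2 hX hM hx hh h0 hbR, hq]
      simp
  · simp only [hg0, card_filter_eq_self, Nat.cast_one]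
  · simp only [hg1]
    rw [← hq, ← card_algebraMap_ne_zero (F := F) (K := K)]
  · have h1 := card_filter_normForm_trace h2 hh hpre (fun y t => y = 0 ∧ t = 0) g {0, 2}
      (fun b => (hcls b).1)
    have h3 : zeroCount σ 1 =
        Finset.card {c : K | normForm σ c = 0 ∧ Algebra.trace F K c = 0} := by simp [zeroCount]
    rw [← h3, Finset.sum_pair (by decide)] at h1
    rw [← hw, ← hq, ← hN1, h1]
    push_cast
    rfl
  · have h1 := card_filter_normForm_trace h2 hh hpre (fun y t => y = 0 ∧ t ≠ 0) g {3}
      (fun b => (hcls b).2.1)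
    have h3 := zeroCount_zero_eq_add σ
    rw [Finset.sum_singleton] at h1
    have h4 : (zeroCount σ 0 : ℤ) - zeroCount σ 1 = w * Finset.card {b | g b = 3} := by
      rw [h3, ← hw]
      push_cast
      rw [add_sub_cancel_left]
      exact_mod_cast h1
    rw [← h4, hN0, hN1, hq]
    ring
  · have h1 := card_filter_normForm_trace h2 hh hpre
      (fun y t => t ^ 2 - 4 * normForm σ h * y = 0) g {0, 1, 2, 4} (fun b => (hcls b).2.2.1)
    rw [card_disc_eq_zero h2 hh h0] at h1
    rw [← hw]
    have h3 : (Fintype.card F : ℤ) * zeroCount σ 1 =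
      Nat.card (LinearMap.ker (polarMap σ)) * (Finset.card {b | g b = 0} +
        (Finset.card {b | g b = 1} + (Finset.card {b | g b = 2} + Finset.card {b | g b = 4}))) := by
      rw [Finset.sum_insert (by decide), Finset.sum_insert (by decide),
        Finset.sum_pair (by decide)] at h1
      exact_mod_cast h1
    rw [hN1, hq] at h3
    linear_combination -h3
  · have h1 := card_filter_normForm_trace h2 hh hpre
      (fun y t => t ^ 2 - 4 * normForm σ h * y ≠ 0 ∧ IsSquare (t ^ 2 - 4 * normForm σ h * y)) g
      {3, 5} (fun b => (hcls b).2.2.2)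
    have h3 := two_mul_card_isSquare_disc h2 hh h0
    rw [Finset.sum_pair (by decide)] at h1
    have h5 := zeroCount_zero_eq_add σ
    have h4 : 2 * (w * ((Finset.card {b | g b = 3} : ℤ) + Finset.card {b | g b = 5})) =
        Fintype.card F * ((zeroCount σ 0 : ℤ) - zeroCount σ 1) := by
      rw [h5, ← hw]
      push_cast
      rw [add_sub_cancel_left]
      rw [← Nat.cast_add, ← Nat.cast_mul, ← h1]
      exact_mod_cast h3
    rw [h4, hN0, hN1, hq]
    ring
  · have h1 := card_filter_eq_sum_fibers g Finset.univ (P := fun _ => True) (by simp)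
    simp only [Finset.filter_true, Finset.card_univ, Fin.sum_univ_succ, Fin.sum_univ_zero] at h1
    rw [← hq, ← hM, h1]
    push_cast
    simp only [← add_assoc, add_zero]

end Classes

/-! ### Classes of messages when Q(h) = 0 -/

section IsotropicClasses

open scoped Classical in
/-- The index of the class of a message with given properties, when the form vanishes on the
constants. -/
noncomputable def isotropicClassIndex (p0 pF pR pQ pT : Prop) : Fin 5 :=
  if p0 then 0 else if pF then 1 else if pR then if pT then 4 else if pQ then 2 else 3 else 4

theorem isotropicClassIndex_eq_zero_iff {p0 pF pR pQ pT : Prop} :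
    isotropicClassIndex p0 pF pR pQ pT = 0 ↔ p0 := by
  by_cases p0 <;> by_cases pF <;> by_cases pR <;> by_cases pQ <;> by_cases pT <;>
    simp_all [isotropicClassIndex]

theorem isotropicClassIndex_eq_one_iff {p0 pF pR pQ pT : Prop} :
    isotropicClassIndex p0 pF pR pQ pT = 1 ↔ ¬ p0 ∧ pF := by
  by_cases p0 <;> by_cases pF <;> by_cases pR <;> by_cases pQ <;> by_cases pT <;>
    simp_all [isotropicClassIndex]

theorem isotropicClassIndex_mem {p0 pF pR pQ pT : Prop} (h0 : p0 → pT) (h1 : pF → pT) :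
    (pR ∧ pQ ∧ ¬ pT ↔ isotropicClassIndex p0 pF pR pQ pT ∈ ({2} : Finset (Fin 5))) ∧
    (pR ∧ ¬ pT ↔ isotropicClassIndex p0 pF pR pQ pT ∈ ({2, 3} : Finset (Fin 5))) := by
  by_cases p0 <;> by_cases pF <;> by_cases pR <;> by_cases pQ <;> by_cases pT <;>
    simp_all [isotropicClassIndex]

variable {F K : Type*} [Field F] [Fintype F] [Field K] [Fintype K] [Algebra F K] {σ : K ≃ₐ[F] K}
  {X u x : ℤ}

/-- The binary form is now t(s Tr(c) + t Q(c)). For Tr(c) ≠ 0 it has 2q − 1 zeros, whatever Q(c) is.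
For Tr(c) = 0 and b outside F, the changes in N(b) and N(1, b) as Q(c) vanishes or not cancel, and
the weight is the one found outside the image. -/
theorem exists_classes_of_eq_zero (h2 : (2 : F) ≠ 0) (hX : HasGaussSum σ X)
    (hM : (Fintype.card K : ℤ) = Fintype.card F ^ 3 * u) (hx : X = Fintype.card F ^ 2 * x)
    {h : K} (hh : polarMap σ h = 1) (h0 : normForm σ h = 0) {q : ℤ} (hq : (Fintype.card F : ℤ) = q)
    {w : ℤ} (hw : (Nat.card (LinearMap.ker (polarMap σ)) : ℤ) = w) :
    ∃ (g : K → Fin 5) (f : Fin 5 → ℤ), (∀ b, g b = 0 ↔ b = 0) ∧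
      (∀ b, codeWeight σ b = ![0, (q - 1) * (q * u), (q - 1) ^ 2 * (u + x),
        (q - 1) * (q * u - u - x), (q - 1) * (q * u - u)] (g b)) ∧
      (∀ j, (Finset.card {b | g b = j} : ℤ) = f j) ∧ f 0 = 1 ∧ f 1 = q - 1 ∧
      w * f 2 = q * (q - 1) * u ∧ w * (f 2 + f 3) = q ^ 2 * (q - 1) * u ∧
      f 0 + f 1 + f 2 + f 3 + f 4 = q ^ 3 * u := by
  classical
  obtain ⟨pre, hpre⟩ := exists_preimages σ
  set g : K → Fin 5 := fun b => isotropicClassIndex (b = 0) (b ∈ Set.range (algebraMap F K))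
    (b ∈ LinearMap.range (polarMap σ)) (normForm σ (pre b) = 0)
    (Algebra.trace F K (pre b) = 0) with hg
  have hN0 := zeroCount_zero_eq h2 hX hM hx
  have hN1 := zeroCount_one_of_eq_zero h2 hX hM hx hh h0
  have hF1 : ∀ b : K, b ∈ Set.range (algebraMap F K) → Algebra.trace F K (pre b) = 0 := by
    rintro _ ⟨s, rfl⟩
    have hs := algebraMap_mem_range_polarMap hh s
    have e := (hpre _ ⟨_, hs⟩).trans hs.symm
    rw [trace_eq_of_polarMap_eq hh e, map_smul, smul_eq_mul, trace_eq_two_mul_normForm hh, h0,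
      mul_zero, mul_zero]
  have hF0 : ∀ b : K, b = 0 → Algebra.trace F K (pre b) = 0 :=
    fun b hb => hF1 b ⟨0, by rw [hb, map_zero]⟩
  have hg0 : ∀ b, g b = 0 ↔ b = 0 := fun b => isotropicClassIndex_eq_zero_iff
  have hg1 : ∀ b, g b = 1 ↔ b ≠ 0 ∧ b ∈ Set.range (algebraMap F K) :=
    fun b => isotropicClassIndex_eq_one_iff
  have hcls := fun b => isotropicClassIndex_mem (pR := b ∈ LinearMap.range (polarMap σ))
    (pQ := normForm σ (pre b) = 0) (hF0 b) (hF1 b)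
  refine ⟨g, fun j => (Finset.card {b | g b = j} : ℤ), hg0, ?_, fun j => rfl, ?_, ?_, ?_, ?_, ?_⟩
  · intro b
    by_cases hb0 : b = 0
    · rw [(hg0 b).2 hb0, hb0, codeWeight_zero]
      rfl
    by_cases hbF : b ∈ Set.range (algebraMap F K)
    · rw [(hg1 b).2 ⟨hb0, hbF⟩]
      obtain ⟨s, rfl⟩ := hbF
      rw [codeWeight_algebraMap σ (fun h => hb0 (by rw [h, map_zero])), hN0, hN1, hq]
      simp only [Matrix.cons_val_one, Matrix.cons_val_zero]
      ring
    by_cases hbR : b ∈ LinearMap.range (polarMap σ)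
    · have hpb := hpre b hbR
      have hpF : polarMap σ (pre b) ∉ Set.range (algebraMap F K) := by rwa [hpb]
      by_cases hT : Algebra.trace F K (pre b) = 0
      · have : g b = 4 := by
          simp only [hg, isotropicClassIndex, if_true, if_false, hb0, hbF, hbR, hT]
        rw [this, ← hpb]
        by_cases hQ : normForm σ (pre b) = 0
        · refine codeWeight_polarMap_of_normForm_eq_zero h2 hX hM hx hh hpF hQ
            (n := (Fintype.card F : ℤ) ^ 2) ?_ ?_
          · simp only [h0, hT, hQ, mul_zero, add_zero, Finset.filter_true, Finset.card_univ,
              Fintype.card_prod]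
            push_cast
            ring
          · rw [hN0, hN1, hq]
            simp
            ring
        · refine codeWeight_polarMap_of_normForm_ne_zero h2 hX hM hx hh hpF hQ
            (n := (Fintype.card F : ℤ)) ?_ ?_
          · simp only [h0, hT, mul_zero, zero_add]
            exact card_isotropic_square hQ
          · rw [hN0, hN1, hq]
            simp
            ring
      · have hn : (Finset.card {p : F × F | p.1 ^ 2 * normForm σ h +
            p.1 * p.2 * Algebra.trace F K (pre b) + p.2 ^ 2 * normForm σ (pre b) = 0} : ℤ) =
            2 * Fintype.card F - 1 := by
          simp only [h0, mul_zero, zero_add]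
          exact card_isotropic_linear hT _
        by_cases hQ : normForm σ (pre b) = 0
        · have : g b = 2 := by
            simp only [hg, isotropicClassIndex, if_true, if_false, hb0, hbF, hbR, hT, hQ]
          rw [this, ← hpb]
          refine codeWeight_polarMap_of_normForm_eq_zero h2 hX hM hx hh hpF hQ hn ?_
          rw [hN0, hN1, hq]
          simp
          ring
        · have : g b = 3 := by
            simp only [hg, isotropicClassIndex, if_true, if_false, hb0, hbF, hbR, hT, hQ]
          rw [this, ← hpb]
          refine codeWeight_polarMap_of_normForm_ne_zero h2 hX hM hx hh hpF hQ hn ?_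
          rw [hN0, hN1, hq]
          simp
          ring
    · have : g b = 4 := by
        simp only [hg, isotropicClassIndex, if_false, hb0, hbF, hbR]
      rw [this, codeWeight_of_notMem_of_eq_zero h2 hX hM hx hh h0 hbR, hq]
      simp
  · simp only [hg0, card_filter_eq_self, Nat.cast_one]
  · simp only [hg1]
    rw [← hq, ← card_algebraMap_ne_zero (F := F) (K := K)]
  · have h1 := card_filter_normForm_trace h2 hh hpre (fun y t => y = 0 ∧ t ≠ 0) g {2}
      (fun b => (hcls b).1)
    have h3 := zeroCount_zero_eq_add σ
    rw [Finset.sum_singleton] at h1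
    have h4 : (zeroCount σ 0 : ℤ) - zeroCount σ 1 = w * Finset.card {b | g b = 2} := by
      rw [h3, ← hw]
      push_cast
      rw [add_sub_cancel_left]
      exact_mod_cast h1
    rw [← h4, hN0, hN1, hq]
    ring
  · have h1 := card_filter_normForm_trace h2 hh hpre (fun _ t => t ≠ 0) g {2, 3}
      (fun b => (hcls b).2)
    have h3 := mul_card_trace_ne_zero (F := F) (K := K)
    rw [Finset.sum_pair (by decide)] at h1
    have hq0 : q ≠ 0 := by
      rw [← hq]
      exact_mod_cast Fintype.card_ne_zero
    refine mul_left_cancel₀ hq0 ?_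
    have h4 : w * ((Finset.card {b | g b = 2} : ℤ) + Finset.card {b | g b = 3}) =
        Finset.card {c : K | Algebra.trace F K c ≠ 0} := by
      rw [← hw, ← Nat.cast_add, ← Nat.cast_mul, ← h1]
    rw [h4, ← hq, h3, hM]
    ring
  · have h1 := card_filter_eq_sum_fibers g Finset.univ (P := fun _ => True) (by simp)
    simp only [Finset.filter_true, Finset.card_univ, Fin.sum_univ_succ, Fin.sum_univ_zero] at h1
    rw [← hq, ← hM, h1]
    push_cast
    simp only [← add_assoc, add_zero]

end IsotropicClasses

/-! ### Parameters and weight table when Q(h) ≠ 0 -/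

section WeightDistribution

theorem exists_class_of_card_pos {K : Type*} [Fintype K] {n : ℕ} {g : K → Fin n} {f : Fin n → ℤ}
    (hf : ∀ j, (Finset.card {b | g b = j} : ℤ) = f j) {j : Fin n} (hj : 0 < f j) :
    ∃ b, g b = j := by
  rw [← hf, Nat.cast_pos, Finset.card_pos] at hj
  obtain ⟨b, hb⟩ := hj
  exact ⟨b, (Finset.mem_filter.1 hb).2⟩

variable {F ι K : Type*} [Field F] [DecidableEq F] [Fintype ι] [AddCommGroup K] [Module F K]
  {φ : K →ₗ[F] (ι → F)}

theorem injective_of_classes {n : ℕ} {g : K → Fin (n + 1)} (hg0 : ∀ b, g b = 0 ↔ b = 0)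
    {W : Fin (n + 1) → ℤ} (hW : ∀ b, (hammingNorm (φ b) : ℤ) = W (g b))
    (hpos : ∀ j, j ≠ 0 → 0 < W j) : Function.Injective φ := by
  rw [injective_iff_map_eq_zero]
  intro b hb
  by_contra h
  have h1 := hpos _ (mt (hg0 b).1 h)
  rw [← hW, hb, hammingNorm_zero] at h1
  exact lt_irrefl _ h1

theorem isWeightCode_of_classes [Fintype K] (hφ : Function.Injective φ) {n : ℕ}
    {g : K → Fin (n + 1)} (hg0 : ∀ b, g b = 0 ↔ b = 0) {W : Fin (n + 1) → ℤ}
    (hW : ∀ b, (hammingNorm (φ b) : ℤ) = W (g b)) (hne : ∀ j, j ≠ 0 → ∃ b, g b = j) :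
    IsWeightCode (LinearMap.range φ) ((Finset.univ.erase 0).image W).card := by
  refine isWeightCode_range hφ fun w => ?_
  simp only [Finset.mem_image, Finset.mem_erase, Finset.mem_univ, and_true]
  constructor
  · rintro ⟨j, hj, rfl⟩
    obtain ⟨b, rfl⟩ := hne j hj
    exact ⟨b, mt (hg0 b).2 hj, hW b⟩
  · rintro ⟨b, hb, rfl⟩
    exact ⟨g b, mt (hg0 b).1 hb, (hW b).symm⟩

theorem isCode_of_classes (hφ : Function.Injective φ) {m : ℕ} (hm : Module.finrank F K = m)
    {l : ℤ} (hl : (Fintype.card ι : ℤ) = l) {n : ℕ}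
    {g : K → Fin (n + 1)} (hg0 : ∀ b, g b = 0 ↔ b = 0) {W : Fin (n + 1) → ℤ}
    (hW : ∀ b, (hammingNorm (φ b) : ℤ) = W (g b)) (hne : ∀ j, j ≠ 0 → ∃ b, g b = j)
    (j₀ : Fin (n + 1)) (hj₀ : j₀ ≠ 0) (hmin : ∀ j, j ≠ 0 → W j₀ ≤ W j) :
    IsCode (LinearMap.range φ) l m (W j₀) := by
  refine isCode_range hφ hl hm ?_ fun b hb => ?_
  · obtain ⟨b, hb⟩ := hne j₀ hj₀
    exact ⟨b, mt (hg0 b).2 (hb ▸ hj₀), by rw [hW, hb]⟩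
  · rw [hW]
    exact hmin _ (mt (hg0 b).1 hb)

/-- Here `σ` lists the nonzero classes by increasing weight; distinctness is then read off from
consecutive comparisons. -/
theorem card_image_erase_zero_of_injOn {n : ℕ} {W : Fin (n + 1) → ℤ} (σ : Fin n → Fin (n + 1))
    (hσ : ∀ j, j ≠ 0 ↔ ∃ i, σ i = j) (hW : StrictMono (W ∘ σ)) :
    ((Finset.univ.erase 0).image W).card = n := by
  have : (Finset.univ.erase 0).image W = Finset.univ.image (W ∘ σ) := by
    ext w
    simp [hσ]
  rw [this, Finset.card_image_of_injective _ hW.injective, Finset.card_univ, Fintype.card_fin]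

theorem le_of_chain_seven {W : Fin 7 → ℤ} (h54 : W 5 < W 4) (h46 : W 4 < W 6) (h63 : W 6 < W 3)
    (h32 : W 3 < W 2) (h21 : W 2 ≤ W 1) (j : Fin 7) (hj : j ≠ 0) : W 5 ≤ W j := by
  fin_cases j
  · exact absurd rfl hj
  all_goals simp only [Fin.reduceFinMk, Fin.mk_one]; linarith

theorem card_image_chain_six {W : Fin 7 → ℤ} (h54 : W 5 < W 4) (h46 : W 4 < W 6) (h63 : W 6 < W 3)
    (h32 : W 3 < W 2) (h21 : W 2 < W 1) : ((Finset.univ.erase 0).image W).card = 6 := by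
  refine card_image_erase_zero_of_injOn ![5, 4, 6, 3, 2, 1] (by decide) ?_
  rw [Fin.strictMono_iff_lt_succ]
  intro i
  fin_cases i <;> assumption

theorem card_image_chain_five {W : Fin 7 → ℤ} (h54 : W 5 < W 4) (h46 : W 4 < W 6) (h63 : W 6 < W 3)
    (h32 : W 3 < W 2) (h21 : W 2 = W 1) : ((Finset.univ.erase 0).image W).card = 5 := by
  have h : (Finset.univ.erase 0).image W = Finset.univ.image (W ∘ ![5, 4, 6, 3, 2]) := by
    rw [show (Finset.univ.erase 0 : Finset (Fin 7)) = {1, 2, 3, 4, 5, 6} by decide,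
      show (Finset.univ : Finset (Fin 5)) = {0, 1, 2, 3, 4} by decide]
    ext w
    simp [← h21]
    tauto
  have hW : StrictMono (W ∘ ![5, 4, 6, 3, 2]) := by
    rw [Fin.strictMono_iff_lt_succ]
    intro i
    fin_cases i <;> assumption
  rw [h, Finset.card_image_of_injective _ hW.injective, Finset.card_univ, Fintype.card_fin]

/-- After removing the common positive factor (q − 1)yv², the largest two cofactors are yq² − q and
yq² − yq, which agree exactly when y = 1. -/
theorem weights_chain {q y v : ℤ} (hq : 3 ≤ q) (hy : 1 ≤ y) (hv : 1 ≤ v) {W : Fin 7 → ℤ}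
    (w1 : W 1 = (q - 1) * (y * v ^ 2) * (y * q ^ 2 - q))
    (w2 : W 2 = (q - 1) * (y * v ^ 2) * (y * q ^ 2 - y * q))
    (w3 : W 3 = (q - 1) * (y * v ^ 2) * (y * q ^ 2 - y * q - 1))
    (w4 : W 4 = (q - 1) * (y * v ^ 2) * (y * q ^ 2 - y * q - q))
    (w5 : W 5 = (q - 1) * (y * v ^ 2) * (y * q ^ 2 - y * q - q - 1))
    (w6 : W 6 = (q - 1) * (y * v ^ 2) * (y * q ^ 2 - y * q - q + 1)) :
    0 < W 5 ∧ W 5 < W 4 ∧ W 4 < W 6 ∧ W 6 < W 3 ∧ W 3 < W 2 ∧ W 2 ≤ W 1 ∧ (1 < y → W 2 < W 1) ∧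
      (y = 1 → W 2 = W 1) := by
  rw [w1, w2, w3, w4, w5, w6]
  clear w1 w2 w3 w4 w5 w6
  have hU : 0 < (q - 1) * (y * v ^ 2) := by
    have : 0 < q - 1 := by linarith
    positivity
  refine ⟨mul_pos hU ?_, mul_lt_mul_of_pos_left ?_ hU, mul_lt_mul_of_pos_left ?_ hU,
    mul_lt_mul_of_pos_left ?_ hU, mul_lt_mul_of_pos_left ?_ hU, mul_le_mul_of_nonneg_left ?_ hU.le,
    fun hy1 => mul_lt_mul_of_pos_left ?_ hU, fun hy1 => by rw [hy1]; ring⟩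
  -- For q ≥ 3, y(q² − q) ≥ 2yq ≥ 2q > q + 1.
  · have h1 : 2 ≤ q - 1 := by linarith
    have h2 : q ≤ y * q := le_mul_of_one_le_left (by linarith) hy
    have h3 : 2 * (y * q) ≤ (q - 1) * (y * q) := mul_le_mul_of_nonneg_right h1 (by linarith)
    linear_combination h3 + 2 * h2 + hq
  · linarith
  · linarith
  · linarith
  · linarith
  · have : q ≤ y * q := le_mul_of_one_le_left (by linarith) hy
    linarith
  · have : 1 * q < y * q := mul_lt_mul_of_pos_right hy1 (by linarith)
    linarith

theorem frequencies_of_ne_zero {q y v : ℤ} (hq : 3 ≤ q) (hy : 1 ≤ y) (hv : 1 ≤ v)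
    {f : Fin 7 → ℤ} (hf0 : f 0 = 1) (hf1 : f 1 = q - 1)
    (hf2 : v ^ 2 * (f 0 + f 2) = q * (y ^ 2 * v ^ 2 * q))
    (hf3 : v ^ 2 * f 3 = q * (q - 1) * (y ^ 2 * v ^ 2 * q - y * v ^ 2))
    (hf4 : v ^ 2 * (f 0 + f 1 + f 2 + f 4) = q ^ 2 * (y ^ 2 * v ^ 2 * q))
    (hf5 : 2 * (v ^ 2 * (f 3 + f 5)) = q ^ 2 * (q - 1) * (y ^ 2 * v ^ 2 * q - y * v ^ 2))
    (hf6 : f 0 + f 1 + f 2 + f 3 + f 4 + f 5 + f 6 = q ^ 3 * (y ^ 2 * v ^ 2 * q)) :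
    f 2 = y ^ 2 * q ^ 2 - 1 ∧ f 3 = (q - 1) * (y ^ 2 * q ^ 2 - y * q) ∧
    f 4 = (q - 1) * (y ^ 2 * q ^ 2 - 1) ∧
    2 * f 5 = (q - 1) * (q - 2) * (y ^ 2 * q ^ 2 - y * q) ∧
    2 * f 6 = 2 * (y ^ 2 * v ^ 2 * q ^ 4) +
      (y * q ^ 3 - y ^ 2 * q ^ 4 - y ^ 2 * q ^ 3 - y * q ^ 2) ∧ ∀ j, 0 < f j := by
  have hv0 : v ^ 2 ≠ 0 := by positivity
  have e2 : f 2 = y ^ 2 * q ^ 2 - 1 := by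
    refine mul_left_cancel₀ hv0 ?_
    rw [hf0] at hf2
    linear_combination hf2
  have e3 : f 3 = (q - 1) * (y ^ 2 * q ^ 2 - y * q) := by
    refine mul_left_cancel₀ hv0 ?_
    linear_combination hf3
  have e4 : f 4 = (q - 1) * (y ^ 2 * q ^ 2 - 1) := by
    refine mul_left_cancel₀ hv0 ?_
    rw [hf0, hf1, e2] at hf4
    linear_combination hf4
  have e5 : 2 * f 5 = (q - 1) * (q - 2) * (y ^ 2 * q ^ 2 - y * q) := by
    refine mul_left_cancel₀ hv0 ?_
    rw [e3] at hf5
    linear_combination hf5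
  have e6 : 2 * f 6 = 2 * (y ^ 2 * v ^ 2 * q ^ 4) +
      (y * q ^ 3 - y ^ 2 * q ^ 4 - y ^ 2 * q ^ 3 - y * q ^ 2) := by
    rw [hf0, hf1, e2, e3, e4] at hf6
    linear_combination 2 * hf6 - e5
  have hyq : 3 ≤ y * q := hq.trans (le_mul_of_one_le_left (by linarith) hy)
  have hyq1 : 0 < y ^ 2 * q ^ 2 - y * q := by
    have : 0 < y * q * (y * q - 1) := mul_pos (by linarith) (by linarith)
    linear_combination this
  refine ⟨e2, e3, e4, e5, e6, fun j => ?_⟩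
  clear hf2 hf3 hf4 hf5 hf6
  have hq2 : 0 < q - 2 := by linarith
  have hq1 : 0 < q - 1 := by linarith
  have p5 : 0 < 2 * f 5 := by rw [e5]; positivity
  -- Positivity comes from the decomposition 2y²q⁴(v² − 1) + y²q³(q − 1) + yq²(q − 1).
  have p6 : 0 < 2 * f 6 := by
    have h1 : 0 ≤ y ^ 2 * q ^ 4 * (v ^ 2 - 1) :=
      mul_nonneg (by positivity) (sub_nonneg.2 (one_le_pow₀ hv))
    have h3 : 0 < y ^ 2 * q ^ 3 * (q - 1) := by positivity
    have h4 : 0 < y * q ^ 2 * (q - 1) := by positivity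
    rw [e6]
    linear_combination 2 * h1 + h3 + h4
  have p3 : 0 < f 3 := by rw [e3]; positivity
  have p2 : 0 < f 2 := by rw [e2]; linarith
  have p4 : 0 < f 4 := by rw [e4, ← e2]; positivity
  have p0 : 0 < f 0 := by rw [hf0]; exact one_pos
  have p1 : 0 < f 1 := by rw [hf1]; exact hq1
  clear e2 e3 e4 e5 e6 hf0 hf1
  fin_cases j
  · exact p0
  · exact p1
  · exact p2
  · exact p3
  · exact p4
  · exact (mul_pos_iff_of_pos_left two_pos).1 p5
  · exact (mul_pos_iff_of_pos_left two_pos).1 p6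

/-- The weight distribution when the form does not vanish on the constants; here `y = q ^ (r - 2)`
if the rank of the form is `2 * r`, and `v ^ 2` is the order of its radical. -/
theorem weightDistribution_of_ne_zero [Fintype K] {m : ℕ} (hm : Module.finrank F K = m)
    {q y v : ℤ} (hq : 3 ≤ q) (hy : 1 ≤ y) (hv : 1 ≤ v)
    (hl : (Fintype.card ι : ℤ) = (q - 1) * (y ^ 2 * v ^ 2 * q ^ 2 - y * v ^ 2 * q))
    {g : K → Fin 7} {f : Fin 7 → ℤ} (hg0 : ∀ b, g b = 0 ↔ b = 0)
    (hW : ∀ b, (hammingNorm (φ b) : ℤ) = ![0,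
      (q - 1) * (y ^ 2 * v ^ 2 * q ^ 2 - y * v ^ 2 * q),
      (q - 1) * (y ^ 2 * v ^ 2 * q ^ 2 - y ^ 2 * v ^ 2 * q),
      (q - 1) * (y ^ 2 * v ^ 2 * q ^ 2 - y ^ 2 * v ^ 2 * q - y * v ^ 2),
      (q - 1) * (y ^ 2 * v ^ 2 * q ^ 2 - y ^ 2 * v ^ 2 * q - y * v ^ 2 * q),
      (q - 1) * (y ^ 2 * v ^ 2 * q ^ 2 - y ^ 2 * v ^ 2 * q - y * v ^ 2 * q - y * v ^ 2),
      (q - 1) ^ 2 * (y ^ 2 * v ^ 2 * q - y * v ^ 2)] (g b))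
    (hf : ∀ j, (Finset.card {b | g b = j} : ℤ) = f j) (hf0 : f 0 = 1) (hf1 : f 1 = q - 1)
    (hf2 : v ^ 2 * (f 0 + f 2) = q * (y ^ 2 * v ^ 2 * q))
    (hf3 : v ^ 2 * f 3 = q * (q - 1) * (y ^ 2 * v ^ 2 * q - y * v ^ 2))
    (hf4 : v ^ 2 * (f 0 + f 1 + f 2 + f 4) = q ^ 2 * (y ^ 2 * v ^ 2 * q))
    (hf5 : 2 * (v ^ 2 * (f 3 + f 5)) = q ^ 2 * (q - 1) * (y ^ 2 * v ^ 2 * q - y * v ^ 2))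
    (hf6 : f 0 + f 1 + f 2 + f 3 + f 4 + f 5 + f 6 = q ^ 3 * (y ^ 2 * v ^ 2 * q)) :
    IsCode (LinearMap.range φ) ((q - 1) * (y ^ 2 * v ^ 2 * q ^ 2 - y * v ^ 2 * q)) m
      ((q - 1) * (y ^ 2 * v ^ 2 * q ^ 2 - y ^ 2 * v ^ 2 * q - y * v ^ 2 * q - y * v ^ 2)) ∧
    HasWeightTable (LinearMap.range φ)
      [(0, 1),
       ((q - 1) * (y ^ 2 * v ^ 2 * q ^ 2 - y * v ^ 2 * q), q - 1),
       ((q - 1) * (y ^ 2 * v ^ 2 * q ^ 2 - y ^ 2 * v ^ 2 * q), y ^ 2 * q ^ 2 - 1),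
       ((q - 1) * (y ^ 2 * v ^ 2 * q ^ 2 - y ^ 2 * v ^ 2 * q - y * v ^ 2),
          (q - 1) * (y ^ 2 * q ^ 2 - y * q)),
       ((q - 1) * (y ^ 2 * v ^ 2 * q ^ 2 - y ^ 2 * v ^ 2 * q - y * v ^ 2 * q),
          (q - 1) * (y ^ 2 * q ^ 2 - 1)),
       ((q - 1) * (y ^ 2 * v ^ 2 * q ^ 2 - y ^ 2 * v ^ 2 * q - y * v ^ 2 * q - y * v ^ 2),
          (q - 1) / 2 * (y ^ 2 * q ^ 3 - y * q ^ 2 + 2 * (y * q) - 2 * (y ^ 2 * q ^ 2))),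
       ((q - 1) ^ 2 * (y ^ 2 * v ^ 2 * q - y * v ^ 2),
          y ^ 2 * v ^ 2 * q ^ 4 + 1 / 2 * (y * q ^ 3 - y ^ 2 * q ^ 4 - y ^ 2 * q ^ 3 - y * q ^ 2))] ∧
    (1 < y → IsWeightCode (LinearMap.range φ) 6) ∧
    (y = 1 → IsWeightCode (LinearMap.range φ) 5) := by
  set W : Fin 7 → ℤ := ![0,
      (q - 1) * (y ^ 2 * v ^ 2 * q ^ 2 - y * v ^ 2 * q),
      (q - 1) * (y ^ 2 * v ^ 2 * q ^ 2 - y ^ 2 * v ^ 2 * q),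
      (q - 1) * (y ^ 2 * v ^ 2 * q ^ 2 - y ^ 2 * v ^ 2 * q - y * v ^ 2),
      (q - 1) * (y ^ 2 * v ^ 2 * q ^ 2 - y ^ 2 * v ^ 2 * q - y * v ^ 2 * q),
      (q - 1) * (y ^ 2 * v ^ 2 * q ^ 2 - y ^ 2 * v ^ 2 * q - y * v ^ 2 * q - y * v ^ 2),
      (q - 1) ^ 2 * (y ^ 2 * v ^ 2 * q - y * v ^ 2)] with hWdef
  have w1 : W 1 = (q - 1) * (y * v ^ 2) * (y * q ^ 2 - q) := by simp [hWdef]; ring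
  have w2 : W 2 = (q - 1) * (y * v ^ 2) * (y * q ^ 2 - y * q) := by simp [hWdef]; ring
  have w3 : W 3 = (q - 1) * (y * v ^ 2) * (y * q ^ 2 - y * q - 1) := by simp [hWdef]; ring
  have w4 : W 4 = (q - 1) * (y * v ^ 2) * (y * q ^ 2 - y * q - q) := by simp [hWdef]; ring
  have w5 : W 5 = (q - 1) * (y * v ^ 2) * (y * q ^ 2 - y * q - q - 1) := by simp [hWdef]; ring
  have w6 : W 6 = (q - 1) * (y * v ^ 2) * (y * q ^ 2 - y * q - q + 1) := by simp [hWdef]; ring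
  obtain ⟨h5, h54, h46, h63, h32, h21, h21', h21''⟩ := weights_chain hq hy hv w1 w2 w3 w4 w5 w6
  obtain ⟨e2, e3, e4, e5, e6, hfpos⟩ := frequencies_of_ne_zero hq hy hv hf0 hf1 hf2 hf3 hf4 hf5 hf6
  have hpos := le_of_chain_seven h54 h46 h63 h32 h21
  have hinj := injective_of_classes hg0 hW fun j hj => h5.trans_le (hpos j hj)
  have hne : ∀ j, j ≠ 0 → ∃ b, g b = j := fun j hj => exists_class_of_card_pos hf (hfpos j)
  have hN : ∀ j, (Finset.card {b | g b = j} : ℚ) = (![1, q - 1, y ^ 2 * q ^ 2 - 1,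
      (q - 1) * (y ^ 2 * q ^ 2 - y * q), (q - 1) * (y ^ 2 * q ^ 2 - 1),
      (q - 1) / 2 * (y ^ 2 * q ^ 3 - y * q ^ 2 + 2 * (y * q) - 2 * (y ^ 2 * q ^ 2)),
      y ^ 2 * v ^ 2 * q ^ 4 + 1 / 2 * (y * q ^ 3 - y ^ 2 * q ^ 4 - y ^ 2 * q ^ 3 - y * q ^ 2)] :
      Fin 7 → ℚ) j := by
    intro j
    have hj : (Finset.card {b | g b = j} : ℚ) = f j := by rw [← hf]; norm_cast
    rw [hj]
    have e5' : (2 * f 5 : ℚ) = (q - 1) * (q - 2) * (y ^ 2 * q ^ 2 - y * q) := by exact_mod_cast e5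
    have e6' : (2 * f 6 : ℚ) = 2 * (y ^ 2 * v ^ 2 * q ^ 4) +
      (y * q ^ 3 - y ^ 2 * q ^ 4 - y ^ 2 * q ^ 3 - y * q ^ 2) := by exact_mod_cast e6
    fin_cases j
    · simp [hf0]
    · simp [hf1]
    · simp [e2]
    · simp [e3]
    · simp [e4]
    · simp
      linear_combination e5' / 2
    · simp
      linear_combination e6' / 2
  refine ⟨isCode_of_classes hinj hm hl hg0 hW hne 5 (by decide) hpos,
    hasWeightTable_range hinj g W hW _ hN, fun hy1 => ?_, fun hy1 => ?_⟩
  · rw [← card_image_chain_six h54 h46 h63 h32 (h21' hy1)]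
    exact isWeightCode_of_classes hinj hg0 hW hne
  · rw [← card_image_chain_five h54 h46 h63 h32 (h21'' hy1)]
    exact isWeightCode_of_classes hinj hg0 hW hne

end WeightDistribution

/-! ### Parameters and weight table when Q(h) = 0 -/

section IsotropicWeightDistribution

theorem le_of_chain_five {W : Fin 5 → ℤ} (h34 : W 3 < W 4) (h42 : W 4 < W 2) (h21 : W 2 < W 1)
    (j : Fin 5) (hj : j ≠ 0) : W 3 ≤ W j := by
  fin_cases j
  · exact absurd rfl hj
  all_goals simp only [Fin.reduceFinMk, Fin.mk_one]; linarith

theorem card_image_chain_four {W : Fin 5 → ℤ} (h34 : W 3 < W 4) (h42 : W 4 < W 2)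
    (h21 : W 2 < W 1) : ((Finset.univ.erase 0).image W).card = 4 := by
  refine card_image_erase_zero_of_injOn ![3, 4, 2, 1] (by decide) ?_
  rw [Fin.strictMono_iff_lt_succ]
  intro i
  fin_cases i <;> assumption

theorem isotropic_weights_chain {q y v : ℤ} (hq : 3 ≤ q) (hy : 1 ≤ y) (hv : 1 ≤ v) {W : Fin 5 → ℤ}
    (w1 : W 1 = (q - 1) * (y * v ^ 2) * (y * q ^ 2))
    (w2 : W 2 = (q - 1) * (y * v ^ 2) * (y * q ^ 2 - y * q + q - 1))
    (w3 : W 3 = (q - 1) * (y * v ^ 2) * (y * q ^ 2 - y * q - 1))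
    (w4 : W 4 = (q - 1) * (y * v ^ 2) * (y * q ^ 2 - y * q)) :
    0 < W 3 ∧ W 3 < W 4 ∧ W 4 < W 2 ∧ W 2 < W 1 := by
  rw [w1, w2, w3, w4]
  clear w1 w2 w3 w4
  have hU : 0 < (q - 1) * (y * v ^ 2) := by
    have : 0 < q - 1 := by linarith
    positivity
  have h2 : q ≤ y * q := le_mul_of_one_le_left (by linarith) hy
  refine ⟨mul_pos hU ?_, mul_lt_mul_of_pos_left ?_ hU, mul_lt_mul_of_pos_left ?_ hU,
    mul_lt_mul_of_pos_left ?_ hU⟩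
  · have h1 : 2 ≤ q - 1 := by linarith
    have h3 : 2 * (y * q) ≤ (q - 1) * (y * q) := mul_le_mul_of_nonneg_right h1 (by linarith)
    linear_combination h3 + 2 * h2 + 2 * hq
  · linarith
  · linarith
  · linarith

theorem frequencies_of_eq_zero {q y v : ℤ} (hq : 3 ≤ q) (hy : 1 ≤ y) (hv : 1 ≤ v)
    {f : Fin 5 → ℤ} (hf0 : f 0 = 1) (hf1 : f 1 = q - 1)
    (hf2 : v ^ 2 * f 2 = q * (q - 1) * (y ^ 2 * v ^ 2 * q))
    (hf3 : v ^ 2 * (f 2 + f 3) = q ^ 2 * (q - 1) * (y ^ 2 * v ^ 2 * q))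
    (hf4 : f 0 + f 1 + f 2 + f 3 + f 4 = q ^ 3 * (y ^ 2 * v ^ 2 * q)) :
    f 2 = (q - 1) * (y ^ 2 * q ^ 2) ∧ f 3 = (q - 1) ^ 2 * (y ^ 2 * q ^ 2) ∧
    f 4 = y ^ 2 * v ^ 2 * q ^ 4 - y ^ 2 * q ^ 4 + y ^ 2 * q ^ 3 - q ∧ ∀ j, 0 < f j := by
  have hv0 : v ^ 2 ≠ 0 := by positivity
  have e2 : f 2 = (q - 1) * (y ^ 2 * q ^ 2) := by
    refine mul_left_cancel₀ hv0 ?_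
    linear_combination hf2
  have e3 : f 3 = (q - 1) ^ 2 * (y ^ 2 * q ^ 2) := by
    refine mul_left_cancel₀ hv0 ?_
    rw [e2] at hf3
    linear_combination hf3
  have e4 : f 4 = y ^ 2 * v ^ 2 * q ^ 4 - y ^ 2 * q ^ 4 + y ^ 2 * q ^ 3 - q := by
    rw [hf0, hf1, e2, e3] at hf4
    linear_combination hf4
  refine ⟨e2, e3, e4, fun j => ?_⟩
  clear hf2 hf3 hf4
  have hq1 : 0 < q - 1 := by linarith
  have p2 : 0 < f 2 := by rw [e2]; positivity
  have p3 : 0 < f 3 := by rw [e3]; positivity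
  -- The value splits as y²q⁴(v² − 1) + (y² − 1)q³ + q(q − 1)(q + 1).
  have p4 : 0 < f 4 := by
    have h1 : 0 ≤ y ^ 2 * q ^ 4 * (v ^ 2 - 1) :=
      mul_nonneg (by positivity) (sub_nonneg.2 (one_le_pow₀ hv))
    have h3 : 0 ≤ (y ^ 2 - 1) * q ^ 3 :=
      mul_nonneg (sub_nonneg.2 (one_le_pow₀ hy)) (by positivity)
    have h4 : 0 < q * (q - 1) * (q + 1) := by positivity
    rw [e4]
    linear_combination h1 + h3 + h4
  have p0 : 0 < f 0 := by rw [hf0]; exact one_pos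
  have p1 : 0 < f 1 := by rw [hf1]; exact hq1
  clear e2 e3 e4 hf0 hf1
  fin_cases j
  · exact p0
  · exact p1
  · exact p2
  · exact p3
  · exact p4

variable {F ι K : Type*} [Field F] [DecidableEq F] [Fintype ι] [AddCommGroup K] [Module F K]
  {φ : K →ₗ[F] (ι → F)}

/-- The weight distribution when the form vanishes on the constants; here `y = q ^ (r - 2)` if the
rank of the form is `2 * r`, and `v ^ 2` is the order of its radical. -/
theorem weightDistribution_of_eq_zero [Fintype K] {m : ℕ} (hm : Module.finrank F K = m)
    {q y v : ℤ} (hq : 3 ≤ q) (hy : 1 ≤ y) (hv : 1 ≤ v)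
    (hl : (Fintype.card ι : ℤ) = (q - 1) * (y ^ 2 * v ^ 2 * q ^ 2))
    {g : K → Fin 5} {f : Fin 5 → ℤ} (hg0 : ∀ b, g b = 0 ↔ b = 0)
    (hW : ∀ b, (hammingNorm (φ b) : ℤ) = ![0,
      (q - 1) * (y ^ 2 * v ^ 2 * q ^ 2),
      (q - 1) ^ 2 * (y ^ 2 * v ^ 2 * q + y * v ^ 2),
      (q - 1) * (y ^ 2 * v ^ 2 * q ^ 2 - y ^ 2 * v ^ 2 * q - y * v ^ 2),
      (q - 1) * (y ^ 2 * v ^ 2 * q ^ 2 - y ^ 2 * v ^ 2 * q)] (g b))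
    (hf : ∀ j, (Finset.card {b | g b = j} : ℤ) = f j) (hf0 : f 0 = 1) (hf1 : f 1 = q - 1)
    (hf2 : v ^ 2 * f 2 = q * (q - 1) * (y ^ 2 * v ^ 2 * q))
    (hf3 : v ^ 2 * (f 2 + f 3) = q ^ 2 * (q - 1) * (y ^ 2 * v ^ 2 * q))
    (hf4 : f 0 + f 1 + f 2 + f 3 + f 4 = q ^ 3 * (y ^ 2 * v ^ 2 * q)) :
    IsCode (LinearMap.range φ) ((q - 1) * (y ^ 2 * v ^ 2 * q ^ 2)) m
      ((q - 1) * (y ^ 2 * v ^ 2 * q ^ 2 - y ^ 2 * v ^ 2 * q - y * v ^ 2)) ∧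
    HasWeightTable (LinearMap.range φ)
      [(0, 1),
       ((q - 1) * (y ^ 2 * v ^ 2 * q ^ 2), q - 1),
       ((q - 1) ^ 2 * (y ^ 2 * v ^ 2 * q + y * v ^ 2), (q - 1) * (y ^ 2 * q ^ 2)),
       ((q - 1) * (y ^ 2 * v ^ 2 * q ^ 2 - y ^ 2 * v ^ 2 * q - y * v ^ 2),
          (q - 1) ^ 2 * (y ^ 2 * q ^ 2)),
       ((q - 1) * (y ^ 2 * v ^ 2 * q ^ 2 - y ^ 2 * v ^ 2 * q),
          y ^ 2 * v ^ 2 * q ^ 4 - y ^ 2 * q ^ 4 + y ^ 2 * q ^ 3 - q)] ∧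
    IsWeightCode (LinearMap.range φ) 4 := by
  set W : Fin 5 → ℤ := ![0,
      (q - 1) * (y ^ 2 * v ^ 2 * q ^ 2),
      (q - 1) ^ 2 * (y ^ 2 * v ^ 2 * q + y * v ^ 2),
      (q - 1) * (y ^ 2 * v ^ 2 * q ^ 2 - y ^ 2 * v ^ 2 * q - y * v ^ 2),
      (q - 1) * (y ^ 2 * v ^ 2 * q ^ 2 - y ^ 2 * v ^ 2 * q)] with hWdef
  have w1 : W 1 = (q - 1) * (y * v ^ 2) * (y * q ^ 2) := by simp [hWdef]; ring
  have w2 : W 2 = (q - 1) * (y * v ^ 2) * (y * q ^ 2 - y * q + q - 1) := by simp [hWdef]; ring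
  have w3 : W 3 = (q - 1) * (y * v ^ 2) * (y * q ^ 2 - y * q - 1) := by simp [hWdef]; ring
  have w4 : W 4 = (q - 1) * (y * v ^ 2) * (y * q ^ 2 - y * q) := by simp [hWdef]; ring
  obtain ⟨h3, h34, h42, h21⟩ := isotropic_weights_chain hq hy hv w1 w2 w3 w4
  obtain ⟨e2, e3, e4, hfpos⟩ := frequencies_of_eq_zero hq hy hv hf0 hf1 hf2 hf3 hf4
  have hpos := le_of_chain_five h34 h42 h21
  have hinj := injective_of_classes hg0 hW fun j hj => h3.trans_le (hpos j hj)
  have hne : ∀ j, j ≠ 0 → ∃ b, g b = j := fun j hj => exists_class_of_card_pos hf (hfpos j)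
  have hN : ∀ j, (Finset.card {b | g b = j} : ℚ) = (![1, q - 1, (q - 1) * (y ^ 2 * q ^ 2),
      (q - 1) ^ 2 * (y ^ 2 * q ^ 2),
      y ^ 2 * v ^ 2 * q ^ 4 - y ^ 2 * q ^ 4 + y ^ 2 * q ^ 3 - q] : Fin 5 → ℚ) j := by
    intro j
    have hj : (Finset.card {b | g b = j} : ℚ) = f j := by rw [← hf]; norm_cast
    rw [hj]
    fin_cases j
    · simp [hf0]
    · simp [hf1]
    · simp [e2]
    · simp [e3]
    · simp [e4]
  refine ⟨isCode_of_classes hinj hm hl hg0 hW hne 3 (by decide) hpos,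
    hasWeightTable_range hinj g W hW _ hN, ?_⟩
  rw [← card_image_chain_four h34 h42 h21]
  exact isWeightCode_of_classes hinj hg0 hW hne

end IsotropicWeightDistribution

/-! ### The code of the defining set, and the main theorem -/

section Main

open scoped Classical in
theorem codeWeight_eq_card {F K : Type*} [Field F] [Field K] [Fintype K] [Algebra F K]
    (σ : K ≃ₐ[F] K) (b : K) : codeWeight σ b = Finset.card {x : K |
      (normForm σ x = 0 ∧ Algebra.trace F K x ≠ 0) ∧ Algebra.trace F K (b * x) ≠ 0} := by
  have h3 := Finset.card_filter_add_card_filter_not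
    (s := {x : K | normForm σ x = 0 ∧ Algebra.trace F K (b * x) = 0})
    (fun x => Algebra.trace F K x = 0)
  have h4 := Finset.card_filter_add_card_filter_not
    (s := {x : K | normForm σ x = 0 ∧ Algebra.trace F K x ≠ 0})
    (fun x => Algebra.trace F K (b * x) = 0)
  rw [Finset.filter_filter, Finset.filter_filter] at h3 h4
  have h5 := zeroCount_zero_eq_add σ
  have h6 : zeroCount₂ σ b = Finset.card {x : K |
      (normForm σ x = 0 ∧ Algebra.trace F K (b * x) = 0) ∧ Algebra.trace F K x = 0} := by
    rw [zeroCount₂]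
    congr 1
    ext x
    simp only [Finset.mem_filter, Finset.mem_univ, true_and]
    tauto
  have h7 : Finset.card {x : K |
      (normForm σ x = 0 ∧ Algebra.trace F K (b * x) = 0) ∧ ¬ Algebra.trace F K x = 0} =
      Finset.card {x : K |
        (normForm σ x = 0 ∧ Algebra.trace F K x ≠ 0) ∧ Algebra.trace F K (b * x) = 0} := by
    congr 1
    ext x
    simp only [Finset.mem_filter, Finset.mem_univ, true_and]
    tauto
  rw [h7, ← h6] at h3
  have h8 : zeroCount σ b = _ := h3.symm
  rw [codeWeight, h5, h8, ← h4]
  push_cast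
  ring

variable {F K : Type*} [Field F] [Fintype F] [DecidableEq F] [Field K] [Fintype K] [DecidableEq K]
  [Algebra F K]

theorem mem_setD2_iff (e : ℕ) (x : K) : x ∈ setD2 K e (0 : F) 0 ↔
    normForm (FiniteField.frobeniusAlgEquivOfAlgebraic F K ^ e) x = 0 ∧
      Algebra.trace F K x ≠ 0 := by
  have hx : normForm (FiniteField.frobeniusAlgEquivOfAlgebraic F K ^ e) x =
      Algebra.trace F K (x ^ (Fintype.card F ^ e + 1)) := by
    rw [normForm, frobenius_pow_apply, pow_succ']
  rw [hx]
  simp only [setD2, setE1, setE2, Finset.mem_sdiff, Finset.mem_filter, Finset.mem_univ, true_and,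
    not_and]
  constructor
  · rintro ⟨⟨h0, h1⟩, h2⟩
    exact ⟨h1, h2 h0⟩
  · rintro ⟨h1, h2⟩
    exact ⟨⟨by rintro rfl; simp at h2, h1⟩, fun _ => h2⟩

theorem card_setD2 (e : ℕ) : (Fintype.card (setD2 K e (0 : F) 0) : ℤ) =
    zeroCount (FiniteField.frobeniusAlgEquivOfAlgebraic F K ^ e) 0 -
      zeroCount (FiniteField.frobeniusAlgEquivOfAlgebraic F K ^ e) 1 := by
  classical
  rw [zeroCount_zero_eq_add, Fintype.card_coe]
  push_cast
  rw [add_sub_cancel_left]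
  congr 2
  ext x
  simp [mem_setD2_iff]

theorem hammingNorm_traceWord (e : ℕ) (b : K) :
    (hammingNorm (traceWord F (setD2 K e (0 : F) 0) b) : ℤ) =
      codeWeight (FiniteField.frobeniusAlgEquivOfAlgebraic F K ^ e) b := by
  have key : ∀ s : Finset K, (∀ x, x ∈ s ↔
      (normForm (FiniteField.frobeniusAlgEquivOfAlgebraic F K ^ e) x = 0 ∧
        Algebra.trace F K x ≠ 0) ∧ Algebra.trace F K (b * x) ≠ 0) →
      hammingNorm (traceWord F (setD2 K e (0 : F) 0) b) = s.card := by
    intro s hs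
    refine Finset.card_bij (fun x _ => (x : K)) ?_ (fun _ _ _ _ h => Subtype.ext h) ?_
    · intro x hx
      exact (hs x).2 ⟨(mem_setD2_iff e _).1 x.2, (Finset.mem_filter.1 hx).2⟩
    · intro x hx
      rw [hs] at hx
      exact ⟨⟨x, (mem_setD2_iff e x).2 hx.1⟩, Finset.mem_filter.2 ⟨Finset.mem_univ _, hx.2⟩, rfl⟩
  rw [codeWeight_eq_card, Nat.cast_inj]
  exact key _ fun x => by simp only [Finset.mem_filter, Finset.mem_univ, true_and]

theorem polarMap_algebraMap_half {F K : Type*} [Field F] [Field K] [Algebra F K]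
    (h2 : (2 : F) ≠ 0) (σ : K ≃ₐ[F] K) :
    polarMap σ (algebraMap F K (1 / 2)) = 1 := by
  rw [polarMap_apply, AlgEquiv.commutes, AlgEquiv.commutes, ← map_add, ← two_mul,
    mul_one_div_cancel h2, map_one]

/-- Automorphisms fix constants, so this is Tr(1/4). In odd characteristic it vanishes exactly when
the characteristic divides the degree, which separates the two cases. -/
theorem normForm_algebraMap_half {F K : Type*} [Field F] [Field K] [Algebra F K]
    (σ : K ≃ₐ[F] K) :
    normForm σ (algebraMap F K (1 / 2)) = (Module.finrank F K : F) * (1 / 2) ^ 2 := by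
  rw [normForm, AlgEquiv.commutes, ← map_mul, Algebra.trace_algebraMap, nsmul_eq_mul]
  ring

/-- The parameters of the form `Tr (x ^ (q ^ e + 1))`. -/
theorem exists_parameters {m ℓ e : ℕ} (hℓ : m = 2 * ℓ) (he : 0 < e)
    (heven : Even (m / Nat.gcd m e)) :
    ∃ d k e', 0 < d ∧ ℓ = d * k ∧ e = d * e' ∧ Odd e' ∧ Nat.Coprime e' k ∧
      eps m e = if Odd k then 0 else d := by
  have hd : 0 < Nat.gcd m e := Nat.gcd_pos_of_pos_right _ he
  obtain ⟨k, hk⟩ := heven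
  obtain ⟨e', he'⟩ := Nat.gcd_dvd_right m e
  have hmd : m = Nat.gcd m e * (2 * k) := by
    rw [two_mul, ← hk, Nat.mul_div_cancel' (Nat.gcd_dvd_left m e)]
  have hℓk : ℓ = Nat.gcd m e * k := by
    have : 2 * ℓ = 2 * (Nat.gcd m e * k) := by rw [← hℓ]; linarith
    omega
  -- These are m and e divided by their gcd; the factor 2 forces e' to be odd.
  have hcop : Nat.Coprime (2 * k) e' := by
    have h := Nat.coprime_div_gcd_div_gcd hd
    rwa [hk, ← two_mul, Nat.div_eq_of_eq_mul_right hd he'] at h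
  refine ⟨Nat.gcd m e, k, e', hd, hℓk, he', ?_, ?_, ?_⟩
  · exact Nat.Coprime.odd_of_left (Nat.Coprime.coprime_mul_right hcop)
  · exact (Nat.Coprime.coprime_mul_left hcop).symm
  · have : m / 2 / Nat.gcd m e = k := by
      rw [hℓ, Nat.mul_div_cancel_left _ two_pos, ← hℓ]
      exact Nat.div_eq_of_eq_mul_right hd hℓk
    rw [eps, this]

end Main

section Main

variable {F K : Type*} [Field F] [Fintype F] [Field K] [Fintype K] [Algebra F K]

theorem hasGaussSum_frobenius (h2 : (2 : F) ≠ 0) {d k e' : ℕ} (hd : 0 < d)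
    (hm : Module.finrank F K = 2 * (d * k)) (hk : Nat.Coprime e' k) (he' : Odd e') :
    HasGaussSum (FiniteField.frobeniusAlgEquivOfAlgebraic F K ^ (d * e'))
      ((Fintype.card F : ℤ) ^ (d * k + if Odd k then 0 else d)) := by
  have hχ := AddChar.FiniteField.primitiveChar_to_Complex_isPrimitive F
  exact ⟨_, hχ, fun z hz => sum_addChar_normForm_frobenius h2 hχ hd hm hk he' hz⟩

end Main

end TraceCode

theorem theorem3 {F K : Type*} [Field F] [Fintype F] [DecidableEq F]
    [Field K] [Fintype K] [DecidableEq K] [Algebra F K]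
    (p q m ℓ e ε : ℕ) [Fact p.Prime] [CharP F p] (hp : p ≠ 2)
    (hq : Fintype.card F = q) (hm : Module.finrank F K = m) (hℓ : m = 2 * ℓ)
    (he : 0 < e) (heven : Even (m / Nat.gcd m e)) (hε : ε = TraceCode.eps m e)
    (hm3 : 3 < m) (hmε : (m : ZMod p) ≠ 0 → 2 * ε + 2 < m) :
    ((m : ZMod p) ≠ 0 →
      TraceCode.IsCode (TraceCode.code F (TraceCode.setD2 K e (0 : F) 0))
        ((q - 1) * (q ^ (m - 2) - q ^ (ℓ + ε - 1)))
        m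
        ((q - 1) * (q ^ (m - 2) - q ^ (m - 3) - q ^ (ℓ + ε - 1) - q ^ (ℓ + ε - 2))) ∧
      TraceCode.HasWeightTable (TraceCode.code F (TraceCode.setD2 K e (0 : F) 0))
        [(0, 1),
         ((q - 1) * (q ^ (m - 2) - q ^ (ℓ + ε - 1)),
            q - 1),
         ((q - 1) * (q ^ (m - 2) - q ^ (m - 3)),
            q ^ (m - 2 * ε - 2) - 1),
         ((q - 1) * (q ^ (m - 2) - q ^ (m - 3) - q ^ (ℓ + ε - 2)),
            (q - 1) * (q ^ (m - 2 * ε - 2) - q ^ (ℓ - ε - 1))),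
         ((q - 1) * (q ^ (m - 2) - q ^ (m - 3) - q ^ (ℓ + ε - 1)),
            (q - 1) * (q ^ (m - 2 * ε - 2) - 1)),
         ((q - 1) * (q ^ (m - 2) - q ^ (m - 3) - q ^ (ℓ + ε - 1) - q ^ (ℓ + ε - 2)),
            (q - 1) / 2 * (q ^ (m - 2 * ε - 1) - q ^ (ℓ - ε) + 2 * q ^ (ℓ - ε - 1)
              - 2 * q ^ (m - 2 * ε - 2))),
         ((q - 1) ^ 2 * (q ^ (m - 3) - q ^ (ℓ + ε - 2)),
            q ^ m + 1 / 2 * (q ^ (ℓ - ε + 1) - q ^ (m - 2 * ε) - q ^ (m - 2 * ε - 1)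
              - q ^ (ℓ - ε)))] ∧
      (m ≠ 2 * ε + 4 →
        TraceCode.IsWeightCode (TraceCode.code F (TraceCode.setD2 K e (0 : F) 0)) 6) ∧
      (m = 2 * ε + 4 →
        TraceCode.IsWeightCode (TraceCode.code F (TraceCode.setD2 K e (0 : F) 0)) 5)) ∧
    ((m : ZMod p) = 0 →
      TraceCode.IsCode (TraceCode.code F (TraceCode.setD2 K e (0 : F) 0))
        ((q - 1) * q ^ (m - 2))
        m
        ((q - 1) * (q ^ (m - 2) - q ^ (m - 3) - q ^ (ℓ + ε - 2))) ∧
      TraceCode.HasWeightTable (TraceCode.code F (TraceCode.setD2 K e (0 : F) 0))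
        [(0, 1),
         ((q - 1) * q ^ (m - 2),
            q - 1),
         ((q - 1) ^ 2 * (q ^ (m - 3) + q ^ (ℓ + ε - 2)),
            (q - 1) * q ^ (m - 2 * ε - 2)),
         ((q - 1) * (q ^ (m - 2) - q ^ (m - 3) - q ^ (ℓ + ε - 2)),
            (q - 1) ^ 2 * q ^ (m - 2 * ε - 2)),
         ((q - 1) * (q ^ (m - 2) - q ^ (m - 3)),
            q ^ m - q ^ (m - 2 * ε) + q ^ (m - 2 * ε - 1) - q)] ∧
      TraceCode.IsWeightCode (TraceCode.code F (TraceCode.setD2 K e (0 : F) 0)) 4) := by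
  have hpp : p.Prime := Fact.out
  have h2 : (2 : F) ≠ 0 := by
    have h : ¬ p ∣ 2 := fun h => hp ((Nat.prime_dvd_prime_iff_eq hpp Nat.prime_two).1 h)
    exact_mod_cast mt (CharP.cast_eq_zero_iff F p 2).1 h
  have hq3 : 3 ≤ q := by
    have h1 : 1 < q := hq ▸ Fintype.one_lt_card
    have h3 : q ≠ 2 := by
      intro h
      have := FiniteField.cast_card_eq_zero F
      rw [hq, h] at this
      exact h2 (by exact_mod_cast this)
    omega
  have hcast : (m : F) = 0 ↔ (m : ZMod p) = 0 := by
    rw [CharP.cast_eq_zero_iff F p, ZMod.natCast_eq_zero_iff]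
  obtain ⟨d, k, e', hd, hℓk, rfl, he', hk, hεk⟩ := TraceCode.exists_parameters hℓ he heven
  rw [hεk] at hε
  have hmk : Module.finrank F K = 2 * (d * k) := by rw [hm, hℓ, hℓk]
  -- This says that the form has rank at least 4. If p does not divide m, it is the extra
  -- hypothesis. Otherwise it could fail only for even k with d = 1 and ℓ = 2; then m = 4, which an
  -- odd p does not divide.
  have hs : ∃ s, ℓ = s + ε + 2 := by
    suffices h : ε + 2 ≤ ℓ from ⟨ℓ - ε - 2, by omega⟩
    by_cases h0 : (m : ZMod p) = 0
    · by_cases hodd : Odd k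
      · rw [if_pos hodd] at hε
        omega
      · rw [if_neg hodd] at hε
        rw [ZMod.natCast_eq_zero_iff] at h0
        obtain ⟨j, hj⟩ := Nat.not_odd_iff_even.1 hodd
        have hj0 : j ≠ 0 := by
          rintro rfl
          simp only [add_zero] at hj
          simp only [hj, mul_zero] at hℓk
          omega
        by_contra hlt
        have h4 : d * 2 ≤ ℓ := by
          rw [hℓk]
          exact Nat.mul_le_mul_left _ (by omega)
        have h5 : m = 2 ^ 2 := by omega
        rw [h5] at h0
        exact hp ((Nat.prime_dvd_prime_iff_eq hpp Nat.prime_two).1 (hpp.dvd_of_dvd_pow h0))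
    · have := hmε h0
      omega
  obtain ⟨s, rfl⟩ := hs
  have hX := TraceCode.hasGaussSum_frobenius (K := K) h2 hd hmk hk he'
  have hker := TraceCode.card_ker_polarMap_frobenius (K := K) (d := d) h2 hmk hk
  rw [← hε, ← hℓk, hq] at hX
  rw [← hε, hq] at hker
  have hcard : Fintype.card K = q ^ m := by rw [Module.card_eq_pow_finrank (K := F), hm, hq]
  subst hℓ
  have hq' : (Fintype.card F : ℤ) = q := by rw [hq]
  -- With y = q^s and v = q^ε, the scaled parameters are u = y²v²q = q^(m−3) and x = yv² =
  -- q^(ℓ+ε−2).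
  have hM : (Fintype.card K : ℤ) =
      Fintype.card F ^ 3 * (((q : ℤ) ^ s) ^ 2 * ((q : ℤ) ^ ε) ^ 2 * q) := by
    rw [hcard, hq]
    push_cast
    ring
  have hx : (q : ℤ) ^ (s + ε + 2 + ε) = Fintype.card F ^ 2 * ((q : ℤ) ^ s * ((q : ℤ) ^ ε) ^ 2) := by
    rw [hq]
    ring
  have hw : (Nat.card (LinearMap.ker (TraceCode.polarMap
      (FiniteField.frobeniusAlgEquivOfAlgebraic F K ^ (d * e')))) : ℤ) = ((q : ℤ) ^ ε) ^ 2 := by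
    rw [hker]
    push_cast
    ring
  have hh := TraceCode.polarMap_algebraMap_half (K := K) h2
    (FiniteField.frobeniusAlgEquivOfAlgebraic F K ^ (d * e'))
  have hQ := TraceCode.normForm_algebraMap_half
    (FiniteField.frobeniusAlgEquivOfAlgebraic F K ^ (d * e'))
  have hqℤ : (3 : ℤ) ≤ q := by exact_mod_cast hq3
  have hy : (1 : ℤ) ≤ (q : ℤ) ^ s := one_le_pow₀ (by linarith)
  have hv : (1 : ℤ) ≤ (q : ℤ) ^ ε := one_le_pow₀ (by linarith)
  -- Writing ℓ = s + ε + 2 shows that none of the natural-number subtractions in the exponents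
  -- truncates.
  have n1 : 2 * (s + ε + 2) - 2 = 2 * s + 2 * ε + 2 := by omega
  have n2 : 2 * (s + ε + 2) - 3 = 2 * s + 2 * ε + 1 := by omega
  have n3 : s + ε + 2 + ε - 1 = s + 2 * ε + 1 := by omega
  have n4 : s + ε + 2 + ε - 2 = s + 2 * ε := by omega
  have n5 : 2 * (s + ε + 2) - 2 * ε - 2 = 2 * s + 2 := by omega
  have n6 : s + ε + 2 - ε - 1 = s + 1 := by omega
  have n7 : 2 * (s + ε + 2) - 2 * ε - 1 = 2 * s + 3 := by omega
  have n8 : s + ε + 2 - ε = s + 2 := by omega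
  have n9 : 2 * (s + ε + 2) - 2 * ε = 2 * s + 4 := by omega
  rw [n1, n2, n3, n4, n5, n6, n7, n8, n9]
  have z1 : (q : ℤ) ^ (2 * s + 2 * ε + 2) = ((q : ℤ) ^ s) ^ 2 * ((q : ℤ) ^ ε) ^ 2 * q ^ 2 := by ring
  have z2 : (q : ℤ) ^ (2 * s + 2 * ε + 1) = ((q : ℤ) ^ s) ^ 2 * ((q : ℤ) ^ ε) ^ 2 * q := by ring
  have z3 : (q : ℤ) ^ (s + 2 * ε + 1) = (q : ℤ) ^ s * ((q : ℤ) ^ ε) ^ 2 * q := by ring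
  have z4 : (q : ℤ) ^ (s + 2 * ε) = (q : ℤ) ^ s * ((q : ℤ) ^ ε) ^ 2 := by ring
  have r1 : (q : ℚ) ^ (2 * s + 2) = ((q : ℚ) ^ s) ^ 2 * q ^ 2 := by ring
  have r2 : (q : ℚ) ^ (s + 1) = (q : ℚ) ^ s * q := by ring
  have r3 : (q : ℚ) ^ (2 * s + 3) = ((q : ℚ) ^ s) ^ 2 * q ^ 3 := by ring
  have r4 : (q : ℚ) ^ (s + 2) = (q : ℚ) ^ s * q ^ 2 := by ring
  have r5 : (q : ℚ) ^ (s + 2 + 1) = (q : ℚ) ^ s * q ^ 3 := by ring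
  have r6 : (q : ℚ) ^ (2 * s + 4) = ((q : ℚ) ^ s) ^ 2 * q ^ 4 := by ring
  have r7 : (q : ℚ) ^ (2 * (s + ε + 2)) = ((q : ℚ) ^ s) ^ 2 * ((q : ℚ) ^ ε) ^ 2 * q ^ 4 := by ring
  simp only [z1, z2, z3, z4, r1, r2, r3, r4, r5, r6, r7]
  have hqu : (q : ℤ) * (((q : ℤ) ^ s) ^ 2 * ((q : ℤ) ^ ε) ^ 2 * q) =
      ((q : ℤ) ^ s) ^ 2 * ((q : ℤ) ^ ε) ^ 2 * q ^ 2 := by ring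
  have hqx : (q : ℤ) * ((q : ℤ) ^ s * ((q : ℤ) ^ ε) ^ 2) = (q : ℤ) ^ s * ((q : ℤ) ^ ε) ^ 2 * q := by
    ring
  have hlen := TraceCode.card_setD2 (F := F) (K := K) (d * e')
  rw [TraceCode.zeroCount_zero_eq h2 hX hM hx] at hlen
  constructor
  · intro h0
    have hQ0 : TraceCode.normForm (FiniteField.frobeniusAlgEquivOfAlgebraic F K ^ (d * e'))
        (algebraMap F K (1 / 2)) ≠ 0 := by
      rw [hQ, hm]
      exact mul_ne_zero (mt hcast.1 h0) (pow_ne_zero _ (one_div_ne_zero h2))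
    obtain ⟨g, f, hg0, hW, hf, hf0, hf1, hf2, hf3, hf4, hf5, hf6⟩ :=
      TraceCode.exists_classes_of_ne_zero h2 hX hM hx hh hQ0 hq' hw
    rw [TraceCode.zeroCount_one_of_ne_zero h2 hX hM hh hQ0, hq'] at hlen
    have key := TraceCode.weightDistribution_of_ne_zero
      (φ := TraceCode.traceWord F (TraceCode.setD2 K (d * e') (0 : F) 0))
      hm hqℤ hy hv (hlen.trans (by ring)) hg0
      (fun b => (TraceCode.hammingNorm_traceWord (d * e') b).trans ((hW b).trans (by
        rw [hqu, hqx]))) hf hf0 hf1 hf2 hf3 hf4 hf5 hf6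
    push_cast at key
    refine ⟨key.1, key.2.1, fun hne => key.2.2.1 ?_, fun h => key.2.2.2 ?_⟩
    -- m ≠ 2ε + 4 means s ≠ 0, hence y > 1.
    · exact one_lt_pow₀ (by linarith) (by omega)
    · rw [show s = 0 by omega, pow_zero]
  · intro h0
    have hQ0 : TraceCode.normForm (FiniteField.frobeniusAlgEquivOfAlgebraic F K ^ (d * e'))
        (algebraMap F K (1 / 2)) = 0 := by
      rw [hQ, hm, hcast.2 h0, zero_mul]
    obtain ⟨g, f, hg0, hW, hf, hf0, hf1, hf2, hf3, hf4⟩ :=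
      TraceCode.exists_classes_of_eq_zero h2 hX hM hx hh hQ0 hq' hw
    rw [TraceCode.zeroCount_one_of_eq_zero h2 hX hM hx hh hQ0, hq'] at hlen
    have key := TraceCode.weightDistribution_of_eq_zero
      (φ := TraceCode.traceWord F (TraceCode.setD2 K (d * e') (0 : F) 0))
      hm hqℤ hy hv (hlen.trans (by ring)) hg0
      (fun b => (TraceCode.hammingNorm_traceWord (d * e') b).trans ((hW b).trans (by
        rw [hqu]))) hf hf0 hf1 hf2 hf3 hf4
    push_cast at key
    exact key
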